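/- Let $k$ be a field, $N\ge 2$, and let $Q$ be the cyclic quiver with vertices $\mathbb Z/N$ and one arrow $\alpha_i\colon i\to i+1$ for every $i$. Let $\mathrm{REL}$ be a nonempty irredundant system of $r$ relations $\alpha_{k_{2i}}\cdots\alpha_{k_{2i-1}+1}\alpha_{k_{2i-1}}=0$ ($1\le i\le r$): each is a path of length at least $2$ (possibly longer than $N$), and none is a subpath of another. Let $\Lambda=kQ/\langle \mathrm{REL}\rangle$ be the corresponding cyclic Nakayama algebra. Modules are right modules, paths are multiplied by writing the path travelled first on the left, and $P_i=e_i\Lambda$ is the indecomposable projective module whose basis is the set of nonzero paths starting at $i$; it has top $S_i$. Put $\mathcal S'(\Lambda)=\{k_{2i}+1 : 1\le i\le r\}\subseteq\mathbb Z/N$, where $S_{k_2},S_{k_4},\dots,S_{k_{2r}}$ are the socles of the projective modules. For $x\in \mathcal S'(\Lambda)$ let $\nu(x)$ be the next element of $\mathcal S'(\Lambda)$ after $x$ in the cyclic order (with $\nu(x)=x$ if $r=1$), and let $\Delta_x$ be the uniserial quotient of $P_x$ with composition factors $S_x,S_{x+1},\dots,S_{\nu(x)-1}$ from top to socle (exactly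 $N$ factors if $r=1$). Put $\mathcal B(\Lambda)=\{\Delta_x : x\in\mathcal S'(\Lambda)\}$, $\mathcal P=\bigoplus_{i\in\mathcal S'(\Lambda)}P_i$, $\varepsilon(\Lambda)=\mathrm{End}_\Lambda(\mathcal P)$ and $H=\mathrm{Hom}_\Lambda(\mathcal P,-)$, a functor from right $\Lambda$-modules to right $\varepsilon(\Lambda)$-modules. Then the following hold. 1. $\varepsilon(\Lambda)$ is a Nakayama algebra, i.e. it is finite-dimensional and all its indecomposable projective left modules and right modules are uniserial. Every finitely generated indecomposable right $\varepsilon(\Lambda)$-module is uniserial. 2. The modules $H(\Delta_x)$, $x\in\mathcal S'(\Lambda)$, are simple and pairwise non-isomorphic, and every simple right $\varepsilon(\Lambda)$-module is isomorphic to one of them; their number is $|\mathcal S'(\Lambda)|=r$. The modules $H(P_x)$, $x\in\mathcal S'(\Lambda)$, are finitely generated indecomposable projective, and every finitely generated indecomposable projective right $\varepsilon(\Lambda)$-module is isomorphic to one of them. 3. Say that $y\in\mathcal S'(\Lambda)$ is the index of the top of $\mathrm{rad}^jH(P_x)$ if $\mathrm{rad}^jH(P_x)/\mathrm{rad}^{j+1}H(P_x)\cong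 H(\Delta_y)$. Let $Q'$ be the quiver with vertex set $\mathcal S'(\Lambda)$ that has exactly one arrow $x\to y$, denoted $\beta_x$, if $y$ is the index of the top of $\mathrm{rad}\,H(P_x)$, and no arrow $x\to y$ otherwise. Then there is an arrow $x\to y$ if and only if $\mathrm{rad}\,H(P_x)\ne0$ and $y=\nu(x)$. For every $x\in\mathcal S'(\Lambda)$ the module $H(P_x)$ has finite length; if $c$ is its length, then $\mathrm{rad}^{c}H(P_x)=0$ and $\nu^{j}(x)$ is the index of the top of $\mathrm{rad}^jH(P_x)$ for $0\le j<c$. 4. For every $x\in\mathcal S'(\Lambda)$ such that $\mathrm{rad}\,H(P_x)$ is not projective there is exactly one path $\beta_{i_m}\circ\cdots\circ\beta_{i_2}\circ\beta_{i_1}$ of $Q'$ (first $\beta_{i_1}$, then $\beta_{i_2}$, and so on) starting at $x$ such that $m$ is the length of $H(P_x)$ and $i_j$ is the index of the top of $\mathrm{rad}^{j-1}H(P_x)$ for $1\le j\le m$. Let $\mathrm{REL}'$ be the set of all these paths. Then $\varepsilon(\Lambda)\cong kQ'/\langle \mathrm{REL}'\rangle$ as $k$-algebras. 5. Let $\mathrm{gl.dim}$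 denote the supremum of the projective dimensions of the finitely generated right modules. If $\mathrm{gl.dim}\,\Lambda=\infty$, then $\varepsilon(\Lambda)$ is a cyclic Nakayama algebra with $r$ vertices, i.e. isomorphic to the quotient of the path algebra of the cyclic quiver with $r$ vertices by the ideal generated by a nonempty irredundant system of paths of length at least $2$ (for $r=1$ the quiver is one loop), and $\mathrm{gl.dim}\,\varepsilon(\Lambda)=\infty$. -/

import Mathlib

universe u v w

open CategoryTheory

noncomputable section

/-! ### Path algebras and bound quiver algebras -/

/-- All paths of a quiver, each with its source and its target. -/
abbrev AllPaths (V : Type v) [Quiver.{w} V] := Σ a b : V, Quiver.Path a b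

/-- The path algebra of a quiver: the free module on the set of all paths. -/
def PathAlgebra (k : Type u) [Field k] (V : Type v) [Quiver.{w} V] := AllPaths V →₀ k

namespace PathAlgebra

variable (k : Type u) [Field k] (V : Type v) [Quiver.{w} V]

instance : AddCommGroup (PathAlgebra k V) := inferInstanceAs (AddCommGroup (AllPaths V →₀ k))

instance : Module k (PathAlgebra k V) := inferInstanceAs (Module k (AllPaths V →₀ k))

variable {V}

/-- A path as an element of the path algebra. -/
def ofPath (p : AllPaths V) : PathAlgebra k V := Finsupp.single p 1

open Classical in
/-- The product of two paths: `p * q` is the path `p` followed by the path `q` if the target of `p`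
is the source of `q`, and `0` otherwise. -/
def mulPath (p q : AllPaths V) : PathAlgebra k V :=
  if h : p.2.1 = q.1 then ofPath k ⟨p.1, q.2.1, p.2.2.comp (q.2.2.cast h.symm rfl)⟩ else 0

/-- The bilinear extension of `mulPath`. -/
def mulHom : PathAlgebra k V →ₗ[k] PathAlgebra k V →ₗ[k] PathAlgebra k V :=
  Finsupp.lift (PathAlgebra k V →ₗ[k] PathAlgebra k V) k (AllPaths V) fun p =>
    Finsupp.lift (PathAlgebra k V) k (AllPaths V) fun q => mulPath k p q

instance : Mul (PathAlgebra k V) := ⟨fun f g => mulHom k f g⟩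

/-- The unit is the sum of the trivial paths. -/
instance [Fintype V] : One (PathAlgebra k V) := ⟨∑ a : V, ofPath k ⟨a, a, Quiver.Path.nil⟩⟩

theorem mul_def (f g : PathAlgebra k V) : f * g = mulHom k f g := rfl

theorem one_def [Fintype V] :
    (1 : PathAlgebra k V) = ∑ a : V, ofPath k ⟨a, a, Quiver.Path.nil⟩ := rfl

theorem ofPath_mul_ofPath (p q : AllPaths V) : ofPath k p * ofPath k q = mulPath k p q := by
  change Finsupp.sum (Finsupp.single p (1 : k)) (fun p c => c • Finsupp.lift (PathAlgebra k V) k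
    (AllPaths V) fun q => mulPath k p q) (Finsupp.single q (1 : k)) = _
  rw [Finsupp.sum_single_index (by exact zero_smul k _), one_smul]
  change Finsupp.sum (Finsupp.single q (1 : k)) (fun q c => c • mulPath k p q) = _
  rw [Finsupp.sum_single_index (by exact zero_smul k _), one_smul]

theorem ofPath_mul_comp {a b c : V} (p : Quiver.Path a b) (q : Quiver.Path b c) :
    ofPath k ⟨a, b, p⟩ * ofPath k ⟨b, c, q⟩ = ofPath k ⟨a, c, p.comp q⟩ := by
  rw [ofPath_mul_ofPath, mulPath, dif_pos rfl]
  rfl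

theorem ofPath_mul_of_ne (p q : AllPaths V) (h : p.2.1 ≠ q.1) :
    ofPath k p * ofPath k q = 0 := by
  rw [ofPath_mul_ofPath, mulPath, dif_neg h]

theorem lhom_ext {M : Type*} [AddCommMonoid M] [Module k M] {f g : PathAlgebra k V →ₗ[k] M}
    (h : ∀ p, f (ofPath k p) = g (ofPath k p)) : f = g :=
  Finsupp.lhom_ext' fun p => LinearMap.ext_ring (h p)

theorem ofPath_mul_assoc (p q r : AllPaths V) :
    ofPath k p * ofPath k q * ofPath k r = ofPath k p * (ofPath k q * ofPath k r) := by
  obtain ⟨a, b, p⟩ := p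
  obtain ⟨c, d, q⟩ := q
  obtain ⟨e, f, r⟩ := r
  have zl (x : PathAlgebra k V) : 0 * x = 0 := by simp [mul_def]
  have zr (x : PathAlgebra k V) : x * 0 = 0 := by simp [mul_def]
  by_cases h₁ : b = c
  · subst h₁
    by_cases h₂ : d = e
    · subst h₂
      simp only [ofPath_mul_comp, Quiver.Path.comp_assoc]
    · rw [ofPath_mul_comp, ofPath_mul_of_ne k _ _ (by exact h₂), ofPath_mul_of_ne k _ _ (by exact h₂),
        zr]
  · rw [ofPath_mul_of_ne k _ _ (by exact h₁), zl]
    by_cases h₂ : d = e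
    · subst h₂
      rw [ofPath_mul_comp, ofPath_mul_of_ne k _ _ (by exact h₁)]
    · rw [ofPath_mul_of_ne k ⟨c, d, q⟩ _ (by exact h₂), zr]

theorem mul_assoc' (f g h : PathAlgebra k V) : f * g * h = f * (g * h) := by
  have h₁ (p q : AllPaths V) : ofPath k p * ofPath k q * h = ofPath k p * (ofPath k q * h) :=
    LinearMap.congr_fun (f := mulHom k (ofPath k p * ofPath k q))
      (g := (mulHom k (ofPath k p)).comp (mulHom k (ofPath k q)))
      (lhom_ext k fun r => ofPath_mul_assoc k p q r) h
  have h₂ (p : AllPaths V) : ofPath k p * g * h = ofPath k p * (g * h) :=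
    LinearMap.congr_fun (f := ((mulHom k).flip h).comp (mulHom k (ofPath k p)))
      (g := (mulHom k (ofPath k p)).comp ((mulHom k).flip h))
      (lhom_ext k fun q => h₁ p q) g
  exact LinearMap.congr_fun (f := ((mulHom k).flip h).comp ((mulHom k).flip g))
      (g := (mulHom k).flip (g * h)) (lhom_ext k fun p => h₂ p) f

theorem one_mul' [Fintype V] (f : PathAlgebra k V) : 1 * f = f := by
  classical
  refine LinearMap.congr_fun (f := mulHom k 1) (g := LinearMap.id) (lhom_ext k fun p => ?_) f
  obtain ⟨a, b, p⟩ := p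
  rw [one_def, map_sum, LinearMap.sum_apply, Finset.sum_eq_single a]
  · exact (ofPath_mul_comp k _ _).trans (by simp)
  · intro c _ hc
    exact ofPath_mul_of_ne k _ _ hc
  · simp

theorem mul_one' [Fintype V] (f : PathAlgebra k V) : f * 1 = f := by
  classical
  refine LinearMap.congr_fun (f := (mulHom k).flip 1) (g := LinearMap.id)
    (lhom_ext k fun p => ?_) f
  obtain ⟨a, b, p⟩ := p
  rw [LinearMap.flip_apply, one_def, map_sum, Finset.sum_eq_single b]
  · exact ofPath_mul_comp k _ _
  · intro c _ hc
    exact ofPath_mul_of_ne k _ _ (Ne.symm hc)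
  · simp

instance [Fintype V] : Ring (PathAlgebra k V) :=
  { (inferInstance : AddCommGroup (PathAlgebra k V)) with
    mul := (· * ·)
    one := 1
    mul_assoc := mul_assoc' k
    one_mul := one_mul' k
    mul_one := mul_one' k
    left_distrib := fun f g h => map_add (mulHom k f) g h
    right_distrib := fun f g h => LinearMap.map_add₂ (mulHom k) f g h
    zero_mul := fun f => LinearMap.map_zero₂ (mulHom k) f
    mul_zero := fun f => map_zero (mulHom k f) }

instance [Fintype V] : Algebra k (PathAlgebra k V) :=
  Algebra.ofModule (fun c f g => LinearMap.map_smul₂ (mulHom k) c f g)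
    (fun c f g => map_smul (mulHom k f) c g)

end PathAlgebra

/-- The relations `p = 0`, for `p` in a set `R` of paths. -/
inductive PathRel (k : Type u) [Field k] {V : Type v} [Quiver.{w} V] (R : Set (AllPaths V)) :
    PathAlgebra k V → PathAlgebra k V → Prop
  | zero (p : AllPaths V) (hp : p ∈ R) : PathRel k R (PathAlgebra.ofPath k p) 0

/-- The bound quiver algebra `kQ/⟨R⟩`: the quotient of the path algebra by the two-sided ideal
generated by a set `R` of paths. -/
def BoundQuiverAlgebra (k : Type u) [Field k] (V : Type v) [Quiver.{w} V] [Fintype V]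
    (R : Set (AllPaths V)) := RingQuot (PathRel k R)

namespace BoundQuiverAlgebra

variable (k : Type u) [Field k] {V : Type v} [Quiver.{w} V] [Fintype V] (R : Set (AllPaths V))

instance : Ring (BoundQuiverAlgebra k V R) := inferInstanceAs (Ring (RingQuot (PathRel k R)))

instance : Algebra k (BoundQuiverAlgebra k V R) :=
  inferInstanceAs (Algebra k (RingQuot (PathRel k R)))

/-- The quotient map from the path algebra. -/
def mk : PathAlgebra k V →ₐ[k] BoundQuiverAlgebra k V R := RingQuot.mkAlgHom k (PathRel k R)

/-- The residue class of a path. -/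
def path (p : AllPaths V) : BoundQuiverAlgebra k V R := mk k R (PathAlgebra.ofPath k p)

end BoundQuiverAlgebra

/-! ### Module-theoretic notions

Right modules over a ring `A` are modules over `Aᵐᵒᵖ`. -/

section Modules

variable (R : Type u) [Ring R] (M : Type v) [AddCommGroup M] [Module R M]

/-- A module is uniserial if its submodules form a chain. -/
def IsUniserial : Prop := ∀ X Y : Submodule R M, X ≤ Y ∨ Y ≤ X

/-- A module is indecomposable if it is nonzero and is not the direct sum of two nonzero
submodules. -/
def IsIndecomposable : Prop :=
  Nontrivial M ∧ ∀ X Y : Submodule R M, IsCompl X Y → X = ⊥ ∨ Y = ⊥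

/-- The top `M / rad M` of a module. -/
abbrev ModuleTop := M ⧸ Module.jacobson R M

/-- The iterated radical `radʲ M`, as a submodule of `M`. -/
def radPow : ℕ → Submodule R M
  | 0 => ⊤
  | j + 1 => (Module.jacobson R (radPow j)).map (radPow j).subtype

end Modules

/-- A finite-dimensional algebra is a Nakayama algebra if all its indecomposable projective
left modules and right modules (finitely generated, as always) are uniserial. -/
def IsNakayama (k : Type u) [Field k] (A : Type u) [Ring A] [Algebra k A] : Prop :=
  Module.Finite k A ∧
  (∀ (P : Type u) [AddCommGroup P] [Module A P], Module.Finite A P → Module.Projective A P →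
    IsIndecomposable A P → IsUniserial A P) ∧
  (∀ (P : Type u) [AddCommGroup P] [Module Aᵐᵒᵖ P], Module.Finite Aᵐᵒᵖ P →
    Module.Projective Aᵐᵒᵖ P → IsIndecomposable Aᵐᵒᵖ P → IsUniserial Aᵐᵒᵖ P)

/-- The global dimension of `mod-A`: the supremum of the projective dimensions of the finitely
generated right `A`-modules. -/
def rightGlobalDimension (A : Type u) [Ring A] : WithBot ℕ∞ :=
  ⨆ (M : ModuleCat.{u} Aᵐᵒᵖ) (_ : Module.Finite Aᵐᵒᵖ M), projectiveDimension M

/-- `Hom(P, X)`, to be regarded as a right module over the endomorphism ring of `P`. -/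
def HomModule (R : Type u) [Ring R] (P : Type v) [AddCommGroup P] [Module R P]
    (X : Type w) [AddCommGroup X] [Module R X] := P →ₗ[R] X

namespace HomModule

variable {R : Type u} [Ring R] {P : Type v} [AddCommGroup P] [Module R P]
  {X : Type w} [AddCommGroup X] [Module R X]

instance : AddCommGroup (HomModule R P X) := inferInstanceAs (AddCommGroup (P →ₗ[R] X))

/-- Right multiplication by an endomorphism `a` of `P` is composition: `f ↦ f ∘ a`. -/
instance : Module (Module.End R P)ᵐᵒᵖ (HomModule R P X) where
  smul a f := LinearMap.comp (f : P →ₗ[R] X) a.unop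
  one_smul _ := LinearMap.ext fun _ => rfl
  mul_smul _ _ _ := LinearMap.ext fun _ => rfl
  smul_zero _ := LinearMap.ext fun _ => rfl
  smul_add _ _ _ := LinearMap.ext fun _ => rfl
  add_smul a b f := LinearMap.ext fun x => LinearMap.map_add f (a.unop x) (b.unop x)
  zero_smul f := LinearMap.ext fun _ => LinearMap.map_zero f

end HomModule

/-! ### Cyclic Nakayama algebras -/

/-- The vertices of the cyclic quiver with `N` vertices. -/
def CyclicVertex (N : ℕ) : Type := ZMod N

namespace CyclicVertex

instance (N : ℕ) : CommRing (CyclicVertex N) := inferInstanceAs (CommRing (ZMod N))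

instance (N : ℕ) : DecidableEq (CyclicVertex N) := inferInstanceAs (DecidableEq (ZMod N))

instance (N : ℕ) [NeZero N] : Fintype (CyclicVertex N) := inferInstanceAs (Fintype (ZMod N))

/-- The cyclic quiver: exactly one arrow `i ⟶ i + 1` for every `i`, and no other arrows. -/
instance (N : ℕ) : Quiver.{0} (CyclicVertex N) := ⟨fun i j => PLift (j = i + 1)⟩

end CyclicVertex

/-- The path of length `d` that starts at the vertex `x` of the cyclic quiver, with its target. -/
def cyclicWalk {N : ℕ} (x : CyclicVertex N) : ℕ → Σ y : CyclicVertex N, Quiver.Path x y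
  | 0 => ⟨x, Quiver.Path.nil⟩
  | d + 1 => ⟨(cyclicWalk x d).1 + 1, (cyclicWalk x d).2.cons ⟨rfl⟩⟩

/-- A nonempty irredundant system of relations for the cyclic quiver with `N` vertices. The pair
`(a, l)` stands for the relation `α_{a+l-1} ⋯ α_{a+1} α_a = 0`, a path of length `l ≥ 2` that
starts at the vertex `a`. Irredundant: no relation is a subpath of another relation. -/
structure CyclicRelations (N : ℕ) where
  rel : Finset (CyclicVertex N × ℕ)
  nonempty : rel.Nonempty
  two_le : ∀ ρ ∈ rel, 2 ≤ ρ.2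
  irredundant : ∀ ρ ∈ rel, ∀ σ ∈ rel,
    (∃ t : ℕ, ρ.1 = σ.1 + (t : CyclicVertex N) ∧ t + ρ.2 ≤ σ.2) → ρ = σ

namespace CyclicRelations

variable {N : ℕ} [NeZero N] (D : CyclicRelations N)

/-- The relations as paths of the cyclic quiver. -/
def paths : Set (AllPaths (CyclicVertex N)) := {p | ∃ ρ ∈ D.rel, p = ⟨ρ.1, cyclicWalk ρ.1 ρ.2⟩}

variable (k : Type u) [Field k]

/-- The cyclic Nakayama algebra `Λ = kQ/⟨REL⟩`. -/
abbrev Alg : Type u := BoundQuiverAlgebra k (CyclicVertex N) D.paths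

/-- The residue class in `Λ` of the path of length `d` that starts at `x`. -/
def walk (x : CyclicVertex N) (d : ℕ) : D.Alg k :=
  BoundQuiverAlgebra.path k D.paths ⟨x, cyclicWalk x d⟩

/-- The indecomposable projective right module `P_x = e_x Λ`, spanned by the paths that start
at `x`. -/
abbrev Proj (x : CyclicVertex N) : Submodule (D.Alg k)ᵐᵒᵖ (D.Alg k) :=
  Submodule.span (D.Alg k)ᵐᵒᵖ {D.walk k x 0}

/-- The index set of `𝒮(Λ)`: for each relation `α_b ⋯ α_a = 0` the vertex `b`; the module `P_a` has
socle `S_b`, and these are the socles of the projective modules. -/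
def socleVertices : Finset (CyclicVertex N) :=
  D.rel.image fun ρ => ρ.1 + (ρ.2 : CyclicVertex N) - 1

/-- The index set of `𝒮'(Λ)`: the cyclic successors of the elements of `𝒮(Λ)`. -/
def syzVertices : Finset (CyclicVertex N) := D.socleVertices.image fun b => b + 1

/-- The number of steps from `x` to the next element of `𝒮'(Λ)` in the cyclic order. -/
def gap (x : CyclicVertex N) : ℕ :=
  sInf {d : ℕ | 1 ≤ d ∧ x + (d : CyclicVertex N) ∈ D.syzVertices}

theorem gap_mem (x : CyclicVertex N) :
    1 ≤ D.gap x ∧ x + (D.gap x : CyclicVertex N) ∈ D.syzVertices := by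
  have hne : D.syzVertices.Nonempty := (D.nonempty.image _).image _
  obtain ⟨y, hy⟩ := hne
  refine Nat.sInf_mem (s := {d : ℕ | 1 ≤ d ∧ x + (d : CyclicVertex N) ∈ D.syzVertices})
    ⟨ZMod.val (n := N) (y - x) + N, ?_, ?_⟩
  · exact le_add_left (NeZero.one_le (n := N))
  · have h₁ : ((ZMod.val (n := N) (y - x) : ℕ) : CyclicVertex N) = y - x :=
      ZMod.natCast_zmod_val (n := N) (y - x)
    have h₂ : ((N : ℕ) : CyclicVertex N) = 0 := ZMod.natCast_self N
    rw [Nat.cast_add, h₁, h₂]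
    simpa using hy

/-- `Δ_x`, for `x ∈ 𝒮'(Λ)`: the uniserial module with composition factors
`S_x, S_{x+1}, …, S_{x+d-1}` from top to socle, where `x + d` is the next element of `𝒮'(Λ)`
(so that `x + d - 1 ∈ 𝒮(Λ)`). It is the quotient of `P_x` by the submodule generated by the
path of length `d` that starts at `x`. -/
abbrev Delta (x : CyclicVertex N) : Type u :=
  D.Proj k x ⧸ (Submodule.span (D.Alg k)ᵐᵒᵖ {D.walk k x (D.gap x)}).submoduleOf (D.Proj k x)

/-- The finite direct sum `⊕_{i ∈ 𝒮'(Λ)} P_i`. -/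
def SyzProj : Type u := ∀ i : {i // i ∈ D.syzVertices}, D.Proj k (i : CyclicVertex N)

instance : AddCommGroup (D.SyzProj k) :=
  inferInstanceAs (AddCommGroup (∀ i : {i // i ∈ D.syzVertices}, D.Proj k (i : CyclicVertex N)))

instance : Module (D.Alg k)ᵐᵒᵖ (D.SyzProj k) :=
  inferInstanceAs (Module (D.Alg k)ᵐᵒᵖ
    (∀ i : {i // i ∈ D.syzVertices}, D.Proj k (i : CyclicVertex N)))

instance : Module k (D.SyzProj k) :=
  inferInstanceAs (Module k (∀ i : {i // i ∈ D.syzVertices}, D.Proj k (i : CyclicVertex N)))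

instance : SMulCommClass (D.Alg k)ᵐᵒᵖ k (D.SyzProj k) :=
  inferInstanceAs (SMulCommClass (D.Alg k)ᵐᵒᵖ k
    (∀ i : {i // i ∈ D.syzVertices}, D.Proj k (i : CyclicVertex N)))

instance : IsScalarTower k (D.Alg k)ᵐᵒᵖ (D.SyzProj k) :=
  inferInstanceAs (IsScalarTower k (D.Alg k)ᵐᵒᵖ
    (∀ i : {i // i ∈ D.syzVertices}, D.Proj k (i : CyclicVertex N)))

/-- The syzygy filtered algebra `ε(Λ)`. -/
abbrev Eps : Type u := Module.End (D.Alg k)ᵐᵒᵖ (D.SyzProj k)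

/-- The functor `H = Hom_Λ(⊕_{i ∈ 𝒮'(Λ)} P_i, -)` from right `Λ`-modules to right
`ε(Λ)`-modules, on objects. -/
abbrev H (X : Type u) [AddCommGroup X] [Module (D.Alg k)ᵐᵒᵖ X] : Type u :=
  HomModule (D.Alg k)ᵐᵒᵖ (D.SyzProj k) X

/-- The vertices of the quiver of `ε(Λ)`: the elements `Δ_x` of `ℬ(Λ)`, indexed by `x ∈ 𝒮'(Λ)`. -/
def EpsVertex (_D : CyclicRelations N) (_k : Type u) : Type := {x // x ∈ _D.syzVertices}

namespace EpsVertex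

variable {D k}

instance : Fintype (D.EpsVertex k) := inferInstanceAs (Fintype {x // x ∈ D.syzVertices})

/-- The element `x` of `𝒮'(Λ)`. -/
def val (x : D.EpsVertex k) : CyclicVertex N := Subtype.val x

/-- The next element of `𝒮'(Λ)` in the cyclic order. -/
def next (x : D.EpsVertex k) : D.EpsVertex k :=
  ⟨x.val + (D.gap x.val : CyclicVertex N), (D.gap_mem x.val).2⟩

/-- The right `ε(Λ)`-module `H(Δ_x)`. -/
abbrev simple (x : D.EpsVertex k) : Type u := D.H k (D.Delta k x.val)

/-- The right `ε(Λ)`-module `H(P_x)`. -/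
abbrev proj (x : D.EpsVertex k) : Type u := D.H k (D.Proj k x.val)

/-- The vertex `y` is the index of the top of `radʲ H(P_x)`. -/
def IsTopIndex (x : D.EpsVertex k) (j : ℕ) (y : D.EpsVertex k) : Prop :=
  Nonempty (ModuleTop (D.Eps k)ᵐᵒᵖ (radPow (D.Eps k)ᵐᵒᵖ x.proj j) ≃ₗ[(D.Eps k)ᵐᵒᵖ] y.simple)

/-- There is an arrow `β_x : x ⟶ y` if `y` is the index of the top of `rad H(P_x)`. -/
instance : Quiver.{0} (D.EpsVertex k) := ⟨fun x y => PLift (x.IsTopIndex 1 y)⟩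

end EpsVertex

/-- The relations of `ε(Λ)`: for every `x` for which `rad H(P_x)` is not projective the path
`β_{i_k} ∘ ⋯ ∘ β_{i_1}`, where `k` is the length of `H(P_x)` and `i_j` is the index of the top of
`rad^{j-1} H(P_x)` for `1 ≤ j ≤ k` (so `i_1 = x`). -/
def epsRelations : Set (AllPaths (D.EpsVertex k)) :=
  {p | ¬ Module.Projective (D.Eps k)ᵐᵒᵖ (radPow (D.Eps k)ᵐᵒᵖ p.1.proj 1) ∧
    (p.2.2.length : ℕ∞) = Module.length (D.Eps k)ᵐᵒᵖ p.1.proj ∧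
    ∀ (j : ℕ) (hj : j < p.2.2.length), p.1.IsTopIndex j
      (p.2.2.vertices[j]'(by rw [Quiver.Path.vertices_length]; omega))}

end CyclicRelations

/-- `A` is isomorphic to a cyclic Nakayama algebra over a cyclic quiver with `n ≥ 1` vertices. -/
def IsCyclicNakayama (k : Type u) [Field k] (A : Type u) [Ring A] [Algebra k A] (n : ℕ) : Prop :=
  ∃ (_ : NeZero n) (D : CyclicRelations n), Nonempty (A ≃ₐ[k] D.Alg k)

end

/-! Both `Λ` and `ε(Λ)` are governed by the same kind of data, a `SerialSystem`: a permutation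
`next` of a finite vertex set together with path classes `w x d` that multiply by concatenation,
span the opposite algebra and vanish from some uniform length on. The only numerical invariant is `c
x`, the first length at which the path from `x` vanishes. All the module theory is derived once from
these axioms. The basic point is that an element is a combination of paths and its shortest
surviving term dominates (`IsAt.exists_span_eq`). Hence a module generated by one element
concentrated at a vertex is uniserial, and is determined by its top `x` and its length `n`. The
simples have length `1`, the indecomposable projectives length `c x`, and the syzygy of `(x, n)` is
`(next^[n] x, c x - n)`. Splitting off a submodule of maximal length shows that there are no other
finitely generated indecomposables.

For `ε(Λ)`, a map `P_y → P_x` is a combination of left multiplications by paths from `x` to `y`.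
With both ends in `𝒮'(Λ)`, such a path makes a whole number `j` of jumps of `ν` and has length
`x.dist j`; so `ε(Λ)` is again serial, with `ν` as successor (`epsSystem`). The module `H(P_x)` is
generated by the projection onto the summand `P_x`, and `H(Δ_x)` has length one because a path
making at least one jump becomes zero in `Δ_x`.

The presentation follows from `c x ≤ c (next x) + 1`: a vanishing path either begins with a relation
starting at `x`, which happens when `c x ≤ c (next x)`, or its tail already vanishes. The condition
`2 ≤ c x ≤ c (next x)` says exactly that `rad H(P_x)` is not projective.

For global dimension, the shortest vanishing path from any vertex ends where a relation ends, so its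
target lies in `𝒮'(Λ)` (`add_c_mem_syzVertices`). Therefore second and later nonzero syzygies over
`Λ` begin and end at `𝒮'(Λ)` and match syzygies over `ε(Λ)` step by step. An infinite chain over `Λ`
gives one over `ε(Λ)`, and such a chain, winding around the single cycle, leaves no room for a
vertex with `c = 1`. -/

noncomputable section

/-! ### Serial systems -/

/-- A multiplicative spanning system of an algebra, indexed by the paths of a quiver all of whose
vertices lie on oriented cycles without branching: `w x d` is the class of the path of length `d`
that starts at `x`. Elements of the algebra act from the left, so that paths are composed like
functions. -/
structure SerialSystem (k : Type u) [Field k] (R : Type v) [Ring R] [Algebra k R]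
    (V : Type w) [Fintype V] where
  next : Equiv.Perm V
  w : V → ℕ → R
  w_zero_ne : ∀ x, w x 0 ≠ 0
  w_mul : ∀ x d e, w (next^[d] x) e * w x d = w x (d + e)
  w_mul_of_ne : ∀ x y d e, y ≠ next^[d] x → w y e * w x d = 0
  sum_w : ∑ x, w x 0 = 1
  exists_w_eq_zero : ∃ n, ∀ x, w x n = 0
  span_w : Submodule.span k (Set.range fun p : V × ℕ => w p.1 p.2) = ⊤

namespace SerialSystem

variable {k : Type u} [Field k] {R : Type v} [Ring R] [Algebra k R] {V : Type w} [Fintype V]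
  (S : SerialSystem k R V)

theorem w_eq_zero_of_le {x : V} {d e : ℕ} (h : S.w x d = 0) (hde : d ≤ e) : S.w x e = 0 := by
  obtain ⟨t, rfl⟩ := Nat.exists_eq_add_of_le hde
  rw [← S.w_mul, h, mul_zero]

theorem exists_w_eq_zero_at (x : V) : ∃ d, S.w x d = 0 :=
  S.exists_w_eq_zero.imp fun _ h => h x

open Classical in
/-- The length of the longest nonzero path that starts at `x`, plus one. -/
def c (x : V) : ℕ := Nat.find (S.exists_w_eq_zero_at x)

theorem w_eq_zero_iff {x : V} {d : ℕ} : S.w x d = 0 ↔ S.c x ≤ d := by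
  classical
  exact ⟨fun h => Nat.find_min' _ h,
    fun h => S.w_eq_zero_of_le (Nat.find_spec (S.exists_w_eq_zero_at x)) h⟩

theorem c_pos (x : V) : 0 < S.c x := by
  by_contra h
  exact S.w_zero_ne x (S.w_eq_zero_iff.2 (by omega))

theorem c_eq_of_forall {x : V} {n : ℕ} (h : ∀ d, S.w x d = 0 ↔ n ≤ d) : S.c x = n :=
  le_antisymm (S.w_eq_zero_iff.1 ((h n).2 le_rfl)) ((h _).1 (S.w_eq_zero_iff.2 le_rfl))

/-- The path of length `c (next x) + 1` from `x` is the arrow at `x` followed by a path that already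
vanishes. -/
theorem c_le (x : V) : S.c x ≤ S.c (S.next x) + 1 := by
  rw [← S.w_eq_zero_iff, add_comm, ← S.w_mul, Function.iterate_one, S.w_eq_zero_iff.2 le_rfl,
    zero_mul]

theorem w_zero_mul (x : V) (d : ℕ) : S.w (S.next^[d] x) 0 * S.w x d = S.w x d := S.w_mul x d 0

theorem w_mul_zero (x : V) (d : ℕ) : S.w x d * S.w x 0 = S.w x d := by
  simpa using S.w_mul x 0 d

theorem w_mul_zero_of_ne {x y : V} (h : y ≠ x) (d : ℕ) : S.w y d * S.w x 0 = 0 :=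
  S.w_mul_of_ne x y 0 d h

/-- Multiplying by the idempotent at `x` removes every spanning path with another source, and paths
of length at least `c x` are zero. -/
theorem exists_expansion (x : V) (r : R) : ∃ a : ℕ → k,
    r * S.w x 0 = ∑ d ∈ Finset.range (S.c x), algebraMap k R (a d) * S.w x d := by
  classical
  have hr : r ∈ Submodule.span k (Set.range fun p : V × ℕ => S.w p.1 p.2) := by
    rw [S.span_w]; trivial
  induction hr using Submodule.span_induction with
  | mem r h =>
    obtain ⟨⟨y, d⟩, rfl⟩ := h
    by_cases hy : y = x
    · subst hy
      refine ⟨Pi.single d 1, ?_⟩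
      simp only [w_mul_zero]
      by_cases hd : d < S.c y
      · rw [Finset.sum_eq_single d]
        · simp
        · intro e _ he
          simp [Pi.single_eq_of_ne he]
        · simp [hd]
      · rw [S.w_eq_zero_iff.2 (not_lt.1 hd), Finset.sum_eq_zero]
        intro e he
        have : e ≠ d := by rintro rfl; exact hd (Finset.mem_range.1 he)
        simp [Pi.single_eq_of_ne this]
    · exact ⟨0, by simp [S.w_mul_zero_of_ne hy]⟩
  | zero => exact ⟨0, by simp⟩
  | add r s _ _ hr hs =>
    obtain ⟨a, ha⟩ := hr
    obtain ⟨b, hb⟩ := hs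
    exact ⟨a + b, by simp [add_mul, ha, hb, Finset.sum_add_distrib]⟩
  | smul t r _ hr =>
    obtain ⟨a, ha⟩ := hr
    refine ⟨t • a, ?_⟩
    simp [ha, Algebra.smul_def, mul_assoc, Finset.mul_sum]

/-! ### Elements concentrated at a vertex -/

section Elements

variable {M : Type*} [AddCommGroup M] [Module R M]

/-- The element `u` is concentrated at the vertex `x`, and the longest path that does not
annihilate it has length `n - 1`. -/
structure IsAt (x : V) (n : ℕ) (u : M) : Prop where
  w_zero_smul : S.w x 0 • u = u
  w_smul_eq_zero_iff : ∀ d, S.w x d • u = 0 ↔ n ≤ d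

variable {S} {x : V} {n : ℕ} {u : M}

theorem w_smul_eq_zero_of_le {d e : ℕ} (h : S.w x d • u = 0) (hde : d ≤ e) : S.w x e • u = 0 := by
  obtain ⟨t, rfl⟩ := Nat.exists_eq_add_of_le hde
  rw [← S.w_mul, mul_smul, h, smul_zero]

variable (S) in
theorem exists_isAt (x : V) (u : M) (h : S.w x 0 • u = u) : ∃ n, S.IsAt x n u := by
  classical
  have hex : ∃ d, S.w x d • u = 0 := ⟨S.c x, by rw [S.w_eq_zero_iff.2 le_rfl, zero_smul]⟩
  exact ⟨Nat.find hex, h, fun d => ⟨fun hd => Nat.find_min' _ hd,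
    fun hd => w_smul_eq_zero_of_le (Nat.find_spec hex) hd⟩⟩

theorem IsAt.le_c (h : S.IsAt x n u) : n ≤ S.c x := by
  rw [← h.w_smul_eq_zero_iff, S.w_eq_zero_iff.2 le_rfl, zero_smul]

theorem IsAt.eq_zero_iff (h : S.IsAt x n u) : u = 0 ↔ n = 0 := by
  have := h.w_smul_eq_zero_iff 0
  rw [h.w_zero_smul] at this
  rw [this]; omega

/-- Truncated subtraction is right here: for `d ≥ n` the element is zero, and zero is concentrated
at every vertex with length `0`. -/
theorem IsAt.w_smul (h : S.IsAt x n u) (d : ℕ) :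
    S.IsAt (S.next^[d] x) (n - d) (S.w x d • u) where
  w_zero_smul := by rw [← mul_smul, S.w_zero_mul]
  w_smul_eq_zero_iff e := by
    rw [← mul_smul, S.w_mul, h.w_smul_eq_zero_iff]; omega

theorem w_smul_of_ne {y : V} (h : S.w x 0 • u = u) (hy : y ≠ x) (d : ℕ) : S.w y d • u = 0 := by
  rw [← h, ← mul_smul, S.w_mul_zero_of_ne hy, zero_smul]

theorem exists_smul_eq_sum (h : S.w x 0 • u = u) (r : R) : ∃ a : ℕ → k,
    r • u = ∑ d ∈ Finset.range (S.c x), algebraMap k R (a d) • S.w x d • u := by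
  obtain ⟨a, ha⟩ := S.exists_expansion x r
  refine ⟨a, ?_⟩
  rw [← h, ← mul_smul, ha, Finset.sum_smul]
  simp [mul_smul, h]

theorem w_smul_mem_span_w_smul {d e : ℕ} (x : V) (u : M) (hde : d ≤ e) :
    S.w x e • u ∈ Submodule.span R {S.w x d • u} := by
  obtain ⟨t, rfl⟩ := Nat.exists_eq_add_of_le hde
  rw [← S.w_mul, mul_smul]
  exact Submodule.smul_mem _ _ (Submodule.mem_span_singleton_self _)

theorem span_w_smul_anti (x : V) (u : M) :
    Antitone fun d => Submodule.span R {S.w x d • u} := by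
  intro d e hde
  exact (Submodule.span_singleton_le_iff_mem _ _).2 (w_smul_mem_span_w_smul x u hde)

/-- Every cyclic submodule of the module generated by `u` is generated by a path. -/
theorem IsAt.exists_span_eq (h : S.IsAt x n u) {v : M} (hv : v ∈ Submodule.span R {u})
    (hv0 : v ≠ 0) : ∃ d < n, Submodule.span R {v} = Submodule.span R {S.w x d • u} := by
  classical
  obtain ⟨r, rfl⟩ := Submodule.mem_span_singleton.1 hv
  obtain ⟨a, ha⟩ := exists_smul_eq_sum h.w_zero_smul r
  -- The least such `d` gives the leading term of `v`; all earlier terms are zero, either by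
  -- coefficient or because the path kills `u`.
  have hex : ∃ d, a d ≠ 0 ∧ d < n := by
    by_contra! hcon
    refine hv0 (ha.trans (Finset.sum_eq_zero fun d _ => ?_))
    by_cases hd : a d = 0
    · simp [hd]
    · rw [(h.w_smul_eq_zero_iff d).2 (hcon d hd), smul_zero]
  obtain ⟨had, hdn⟩ := Nat.find_spec hex
  have hmin : ∀ t < Nat.find hex, a t = 0 ∨ n ≤ t := fun t ht => by
    have := Nat.find_min hex ht
    by_contra! hc
    exact this hc
  generalize Nat.find hex = d at had hdn hmin
  refine ⟨d, hdn, le_antisymm ((Submodule.span_singleton_le_iff_mem _ _).2 ?_)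
    ((Submodule.span_singleton_le_iff_mem _ _).2 ?_)⟩
  · rw [ha]
    refine Submodule.sum_mem _ fun t _ => ?_
    by_cases htd : d ≤ t
    · exact Submodule.smul_mem _ _ (w_smul_mem_span_w_smul x u htd)
    · rcases hmin t (by omega) with h0 | h0
      · simp [h0]
      · simp [(h.w_smul_eq_zero_iff t).2 h0]
  -- Downward induction on `s`: continuing `v` by `s - d` arrows turns the leading term into a
  -- nonzero multiple of `w x s • u`, while every other term either vanishes or is a longer path,
  -- already known to lie in the span.
  · suffices ∀ j s, n ≤ s + j → d ≤ s → S.w x s • u ∈ Submodule.span R {r • u} from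
      this n d (by omega) le_rfl
    intro j
    induction j with
    | zero =>
      intro s hs _
      rw [(h.w_smul_eq_zero_iff s).2 (by omega)]
      exact zero_mem _
    | succ j ih =>
      intro s hs hds
      have hterm : ∀ t ∈ Finset.range (S.c x), t ≠ d →
          S.w (S.next^[d] x) (s - d) • algebraMap k R (a t) • S.w x t • u ∈
            Submodule.span R {r • u} := by
        intro t _ htd
        by_cases hlt : t < d
        · rcases hmin t hlt with h0 | h0
          · simp [h0]
          · simp [(h.w_smul_eq_zero_iff t).2 h0]
        rw [← mul_smul, ← Algebra.commutes, mul_smul, ← mul_smul _ (S.w x t)]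
        refine Submodule.smul_mem _ _ ?_
        by_cases hx : S.next^[d] x = S.next^[t] x
        · rw [hx, S.w_mul]
          exact ih _ (by omega) (by omega)
        · rw [S.w_mul_of_ne _ _ _ _ hx, zero_smul]
          exact zero_mem _
      have hmem : S.w (S.next^[d] x) (s - d) •
          ∑ t ∈ Finset.range (S.c x), algebraMap k R (a t) • S.w x t • u ∈
            Submodule.span R {r • u} := by
        rw [← ha]
        exact Submodule.smul_mem _ _ (Submodule.mem_span_singleton_self _)
      have hdc : d ∈ Finset.range (S.c x) := Finset.mem_range.2 (hdn.trans_le h.le_c)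
      rw [Finset.smul_sum, ← Finset.add_sum_erase _ _ hdc,
        Submodule.add_mem_iff_left _ (Submodule.sum_mem _ fun t ht =>
          hterm t (Finset.mem_of_mem_erase ht) (Finset.ne_of_mem_erase ht)),
        ← mul_smul, ← Algebra.commutes, mul_smul, ← mul_smul _ (S.w x d), S.w_mul,
        Nat.add_sub_cancel' hds] at hmem
      have := Submodule.smul_mem _ (algebraMap k R (a d)⁻¹) hmem
      rwa [← mul_smul, ← map_mul, inv_mul_cancel₀ had, map_one, one_smul] at this

/-- The path of length `n - 1 - d` continuing `w x d` leaves `w x (n - 1) • u ≠ 0`, but it kills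
every multiple of `w x e • u`: each term has the wrong end vertex or total length at least `n`. -/
theorem IsAt.w_smul_notMem (h : S.IsAt x n u) {d e : ℕ} (hd : d < n) (hde : d < e) :
    S.w x d • u ∉ Submodule.span R {S.w x e • u} := by
  intro hmem
  obtain ⟨r, hr⟩ := Submodule.mem_span_singleton.1 hmem
  obtain ⟨a, ha⟩ := exists_smul_eq_sum (h.w_smul e).w_zero_smul r
  have h0 : S.w (S.next^[d] x) (n - 1 - d) • S.w x d • u = 0 := by
    rw [← hr, ha, Finset.smul_sum]
    refine Finset.sum_eq_zero fun t _ => ?_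
    rw [← mul_smul (S.w _ t), S.w_mul, ← mul_smul, ← Algebra.commutes, mul_smul,
      ← mul_smul (S.w _ (n - 1 - d))]
    by_cases hx : S.next^[d] x = S.next^[e + t] x
    · rw [hx, S.w_mul, (h.w_smul_eq_zero_iff _).2 (by omega), smul_zero]
    · rw [S.w_mul_of_ne _ _ _ _ hx, zero_smul, smul_zero]
  rw [← mul_smul, S.w_mul, h.w_smul_eq_zero_iff] at h0
  omega

end Elements

end SerialSystem

namespace SerialSystem

variable {k : Type u} [Field k] {R : Type v} [Ring R] [Algebra k R] {V : Type w} [Fintype V]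
  (S : SerialSystem k R V)

/-! ### Interval modules -/

section Interval

variable {M : Type*} [AddCommGroup M] [Module R M] {M' : Type*} [AddCommGroup M'] [Module R M']

/-- The element `u` generates a uniserial module of length `n` with top at `x`. -/
structure IsGen (M : Type*) [AddCommGroup M] [Module R M] (x : V) (n : ℕ) (u : M) : Prop
    extends S.IsAt x n u where
  span_eq_top : Submodule.span R {u} = ⊤

/-- The module is uniserial of length `n` with top at `x` (if `n ≠ 0`). -/
def IsInterval (M : Type*) [AddCommGroup M] [Module R M] (x : V) (n : ℕ) : Prop :=
  ∃ u : M, S.IsGen M x n u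

variable {S} {x y : V} {n m : ℕ} {u : M}

theorem IsAt.map (h : S.IsAt x n u) (f : M →ₗ[R] M') (hf : Function.Injective f) :
    S.IsAt x n (f u) where
  w_zero_smul := by rw [← map_smul, h.w_zero_smul]
  w_smul_eq_zero_iff d := by
    rw [← map_smul, ← h.w_smul_eq_zero_iff, map_eq_zero_iff f hf]

theorem IsGen.map (h : S.IsGen M x n u) (f : M ≃ₗ[R] M') : S.IsGen M' x n (f u) where
  toIsAt := h.toIsAt.map f.toLinearMap f.injective
  span_eq_top := by
    have := congrArg (Submodule.map f.toLinearMap) h.span_eq_top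
    rw [Submodule.map_span, Set.image_singleton, Submodule.map_top, LinearEquiv.range] at this
    exact this

theorem IsInterval.of_equiv (h : S.IsInterval M x n) (f : M ≃ₗ[R] M') : S.IsInterval M' x n :=
  h.imp' f fun _ hu => hu.map f

theorem IsAt.isGen_span (h : S.IsAt x n u) :
    S.IsGen (Submodule.span R {u}) x n ⟨u, Submodule.mem_span_singleton_self u⟩ where
  w_zero_smul := Subtype.ext h.w_zero_smul
  w_smul_eq_zero_iff d := by
    rw [← h.w_smul_eq_zero_iff, Subtype.ext_iff]; rfl
  span_eq_top := by
    refine Submodule.map_injective_of_injective (Submodule.injective_subtype _) ?_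
    rw [Submodule.map_span, Set.image_singleton, Submodule.map_top, Submodule.range_subtype]
    rfl

theorem IsAt.isInterval_span (h : S.IsAt x n u) : S.IsInterval (Submodule.span R {u}) x n :=
  ⟨_, h.isGen_span⟩

/-- Take the shortest path carrying `u` into `X`; a nonzero `v` in `X` spans the same submodule as
some path applied to `u`, which cannot be shorter. -/
theorem IsGen.exists_eq_span (h : S.IsGen M x n u) (X : Submodule R M) :
    ∃ d ≤ n, X = Submodule.span R {S.w x d • u} := by
  classical
  have hex : ∃ d, S.w x d • u ∈ X :=
    ⟨n, by rw [(h.w_smul_eq_zero_iff n).2 le_rfl]; exact zero_mem _⟩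
  refine ⟨Nat.find hex, Nat.find_min' _ ?_, le_antisymm (fun v hv => ?_)
    ((Submodule.span_singleton_le_iff_mem _ _).2 (Nat.find_spec hex))⟩
  · rw [(h.w_smul_eq_zero_iff n).2 le_rfl]; exact zero_mem _
  by_cases hv0 : v = 0
  · rw [hv0]; exact zero_mem _
  obtain ⟨d, -, hd⟩ := h.exists_span_eq (h.span_eq_top ▸ Submodule.mem_top : v ∈ _) hv0
  have hdX : S.w x d • u ∈ X := (Submodule.span_singleton_le_iff_mem _ _).1
    (hd ▸ (Submodule.span_singleton_le_iff_mem _ _).2 hv)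
  have hv' : v ∈ Submodule.span R {S.w x d • u} := hd ▸ Submodule.mem_span_singleton_self v
  exact span_w_smul_anti x u (Nat.find_min' hex hdX) hv'

theorem IsGen.span_w_zero (h : S.IsGen M x n u) : Submodule.span R {S.w x 0 • u} = ⊤ := by
  rw [h.w_zero_smul, h.span_eq_top]

theorem IsGen.isUniserial (h : S.IsGen M x n u) : IsUniserial R M := by
  intro X Y
  obtain ⟨d, -, rfl⟩ := h.exists_eq_span X
  obtain ⟨e, -, rfl⟩ := h.exists_eq_span Y
  exact (le_total e d).imp (fun hd => span_w_smul_anti x u hd) fun hd => span_w_smul_anti x u hd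

theorem IsInterval.isUniserial (h : S.IsInterval M x n) : IsUniserial R M :=
  h.elim fun _ hu => hu.isUniserial

theorem IsGen.nontrivial (h : S.IsGen M x n u) (hn : n ≠ 0) : Nontrivial M :=
  ⟨u, 0, fun h0 => hn (h.eq_zero_iff.1 h0)⟩

theorem IsGen.subsingleton (h : S.IsGen M x 0 u) : Subsingleton M := by
  rw [← Submodule.subsingleton_iff R, ← subsingleton_iff_bot_eq_top, ← h.span_eq_top,
    h.eq_zero_iff.2 rfl, Submodule.span_zero_singleton]

theorem IsInterval.subsingleton_iff (h : S.IsInterval M x n) : Subsingleton M ↔ n = 0 := by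
  obtain ⟨u, hu⟩ := h
  refine ⟨fun hs => ?_, fun hn => ?_⟩
  · by_contra hn
    have := hu.nontrivial hn
    exact not_subsingleton M hs
  · subst hn
    exact hu.subsingleton

theorem isIndecomposable_of_isUniserial {R : Type*} [Ring R] {M : Type*} [AddCommGroup M]
    [Module R M] [Nontrivial M] (h : IsUniserial R M) : IsIndecomposable R M := by
  refine ⟨inferInstance, fun X Y hXY => (h X Y).imp (fun hle => ?_) fun hle => ?_⟩
  · exact le_bot_iff.1 (hXY.inf_eq_bot ▸ le_inf le_rfl hle)
  · exact le_bot_iff.1 (hXY.inf_eq_bot ▸ le_inf hle le_rfl)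

theorem IsInterval.isIndecomposable (h : S.IsInterval M x n) (hn : n ≠ 0) :
    IsIndecomposable R M := by
  have : Nontrivial M := not_subsingleton_iff_nontrivial.1 (mt h.subsingleton_iff.1 hn)
  exact isIndecomposable_of_isUniserial h.isUniserial

/-- Every proper submodule is generated by a path of positive length, so the arrow generates the
unique maximal one. If `n = 0` there is no maximal submodule, but the module is zero. -/
theorem IsGen.jacobson_eq (h : S.IsGen M x n u) :
    Module.jacobson R M = Submodule.span R {S.w x 1 • u} := by
  by_cases hn : n = 0
  · subst hn
    have := (Submodule.subsingleton_iff R).2 h.subsingleton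
    exact Subsingleton.elim _ _
  have hlt {d : ℕ} (hd : 1 ≤ d) : Submodule.span R {S.w x d • u} ≠ ⊤ := by
    intro htop
    refine h.w_smul_notMem (d := 0) (e := d) (by omega) (by omega) ?_
    rw [htop]; trivial
  have hco (X : Submodule R M) : IsCoatom X ↔ X = Submodule.span R {S.w x 1 • u} := by
    have hle (Y : Submodule R M) (hY : Y ≠ ⊤) : Y ≤ Submodule.span R {S.w x 1 • u} := by
      obtain ⟨d, -, rfl⟩ := h.exists_eq_span Y
      refine span_w_smul_anti x u (Nat.one_le_iff_ne_zero.2 ?_)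
      rintro rfl
      exact hY h.span_w_zero
    have h1 : IsCoatom (Submodule.span R {S.w x 1 • u}) :=
      ⟨hlt le_rfl, fun Y hY => by
        by_contra hne
        exact (hY.trans_le (hle Y hne)).false⟩
    refine ⟨fun hX => ?_, fun hX => hX ▸ h1⟩
    rcases eq_or_lt_of_le (hle X hX.1) with he | hl
    · exact he
    · exact absurd (hX.2 _ hl) (hlt le_rfl)
  simp [Module.jacobson, hco]

theorem IsGen.radPow_eq (h : S.IsGen M x n u) (j : ℕ) :
    radPow R M j = Submodule.span R {S.w x j • u} := by
  induction j with
  | zero => exact h.span_w_zero.symm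
  | succ j ih =>
    have hg := (h.w_smul j).isGen_span
    have hj := hg.jacobson_eq
    rw [radPow, ih, hj, Submodule.map_span, Set.image_singleton]
    congr 2
    change S.w (S.next^[j] x) 1 • S.w x j • u = _
    rw [← mul_smul, S.w_mul]

theorem IsInterval.radPow (h : S.IsInterval M x n) (j : ℕ) :
    S.IsInterval (radPow R M j) (S.next^[j] x) (n - j) := by
  obtain ⟨u, hu⟩ := h
  rw [hu.radPow_eq]
  exact (hu.w_smul j).isInterval_span

theorem IsInterval.radPow_eq_bot_iff (h : S.IsInterval M x n) (j : ℕ) :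
    _root_.radPow R M j = ⊥ ↔ n ≤ j := by
  rw [← Submodule.subsingleton_iff_eq_bot, (h.radPow j).subsingleton_iff]
  omega

theorem IsGen.quotient (h : S.IsGen M x n u) {d : ℕ} (hd : d ≤ n) :
    S.IsGen (M ⧸ Submodule.span R {S.w x d • u}) x d
      (Submodule.Quotient.mk u : M ⧸ Submodule.span R {S.w x d • u}) where
  w_zero_smul := by rw [← Submodule.Quotient.mk_smul, h.w_zero_smul]
  w_smul_eq_zero_iff e := by
    rw [← Submodule.Quotient.mk_smul, Submodule.Quotient.mk_eq_zero]
    refine ⟨fun he => ?_, fun he => w_smul_mem_span_w_smul x u he⟩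
    by_contra hlt
    exact h.w_smul_notMem (by omega) (by omega) he
  span_eq_top := by
    have := congrArg (Submodule.map (Submodule.span R {S.w x d • u}).mkQ) h.span_eq_top
    rwa [Submodule.map_span, Set.image_singleton, Submodule.map_top, Submodule.range_mkQ] at this

theorem IsInterval.moduleTop (h : S.IsInterval M x n) (hn : n ≠ 0) :
    S.IsInterval (ModuleTop R M) x 1 := by
  obtain ⟨u, hu⟩ := h
  unfold ModuleTop
  rw [hu.jacobson_eq]
  exact ⟨_, hu.quotient (by omega)⟩

theorem IsInterval.isSimpleModule (h : S.IsInterval M x 1) : IsSimpleModule R M := by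
  obtain ⟨u, hu⟩ := h
  have := hu.nontrivial one_ne_zero
  rw [isSimpleModule_iff]
  refine ⟨fun X => ?_⟩
  obtain ⟨d, hd, rfl⟩ := hu.exists_eq_span X
  interval_cases d
  · exact Or.inr hu.span_w_zero
  · left
    rw [(hu.w_smul_eq_zero_iff 1).2 le_rfl, Submodule.span_zero_singleton]

theorem IsInterval.length_eq (h : S.IsInterval M x n) : Module.length R M = n := by
  induction n generalizing x M with
  | zero =>
    have := h.subsingleton_iff.2 rfl
    simp
  | succ n ih =>
    obtain ⟨u, hu⟩ := h
    have h1 := (hu.w_smul 1).isInterval_span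
    have h2 : S.IsInterval (M ⧸ Submodule.span R {S.w x 1 • u}) x 1 :=
      ⟨_, hu.quotient (by omega)⟩
    have := h2.isSimpleModule
    rw [Module.length_eq_add_of_exact (Submodule.span R {S.w x 1 • u}).subtype
      (Submodule.span R {S.w x 1 • u}).mkQ (Submodule.injective_subtype _)
      (Submodule.mkQ_surjective _) (LinearMap.exact_subtype_mkQ _), ih h1, Module.length_eq_one]
    simp

/-- Surviving paths applied to `u` are independent: continue by `n - 1 - d` arrows. Smaller
coefficients vanish by induction, larger terms become too long or do not compose, and only the
multiple of `w x (n - 1) • u` by `a d` is left. -/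
theorem IsAt.coeff_eq_zero (h : S.IsAt x n u) {a : ℕ → k} {s : Finset ℕ}
    (ha : ∑ d ∈ s, algebraMap k R (a d) • S.w x d • u = 0) {d : ℕ} (hds : d ∈ s) (hd : d < n) :
    a d = 0 := by
  induction d using Nat.strong_induction_on with
  | _ d ih =>
  have h0 : S.w (S.next^[d] x) (n - 1 - d) •
      ∑ t ∈ s, algebraMap k R (a t) • S.w x t • u = 0 := by rw [ha, smul_zero]
  rw [Finset.smul_sum, Finset.sum_eq_single d, ← mul_smul, ← Algebra.commutes, mul_smul,
    ← mul_smul _ (S.w x d), S.w_mul, Nat.add_sub_cancel' (by omega)] at h0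
  · by_contra had
    have h1 : S.w x (n - 1) • u = algebraMap k R (a d)⁻¹ • algebraMap k R (a d) •
        S.w x (n - 1) • u := by
      rw [← mul_smul _ (algebraMap k R (a d)), ← map_mul, inv_mul_cancel₀ had, map_one, one_smul]
    rw [h0, smul_zero, h.w_smul_eq_zero_iff] at h1
    omega
  · intro t hts htd
    rw [← mul_smul, ← Algebra.commutes, mul_smul, ← mul_smul _ (S.w x t)]
    by_cases hlt : t < d
    · rw [ih t hlt hts (by omega), map_zero, zero_smul]
    by_cases hx : S.next^[d] x = S.next^[t] x
    · rw [hx, S.w_mul, (h.w_smul_eq_zero_iff _).2 (by omega), smul_zero]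
    · rw [S.w_mul_of_ne _ _ _ _ hx, zero_smul, smul_zero]
  · exact fun hn => absurd hds hn

/-- The annihilator of an element concentrated at `x` depends only on its length. -/
theorem IsAt.smul_eq_zero_of_isAt (h : S.IsAt x n u) {u' : M'} (h' : S.IsAt x n u') {r : R}
    (hr : r • u = 0) : r • u' = 0 := by
  obtain ⟨a, ha⟩ := S.exists_expansion x r
  have h1 : ∑ d ∈ Finset.range (S.c x), algebraMap k R (a d) • S.w x d • u = 0 := by
    rw [← hr, ← h.w_zero_smul, ← mul_smul r, ha, Finset.sum_smul]
    simp [mul_smul, h.w_zero_smul]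
  rw [← h'.w_zero_smul, ← mul_smul, ha, Finset.sum_smul]
  refine Finset.sum_eq_zero fun d hdc => ?_
  by_cases hd : d < n
  · rw [h.coeff_eq_zero h1 hdc hd, map_zero, zero_mul, zero_smul]
  · rw [mul_smul, (h'.w_smul_eq_zero_iff d).2 (by omega), smul_zero]

theorem IsGen.toSpanSingleton_surjective (h : S.IsGen M x n u) :
    Function.Surjective (LinearMap.toSpanSingleton R M u) := by
  rw [← LinearMap.range_eq_top, LinearMap.range_toSpanSingleton, h.span_eq_top]

/-- The two generators have the same annihilator, so both modules are the same quotient of `R`. -/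
theorem IsInterval.nonempty_equiv (h : S.IsInterval M x n) (h' : S.IsInterval M' x n) :
    Nonempty (M ≃ₗ[R] M') := by
  obtain ⟨u, hu⟩ := h
  obtain ⟨u', hu'⟩ := h'
  have hker : LinearMap.ker (LinearMap.toSpanSingleton R M u) =
      LinearMap.ker (LinearMap.toSpanSingleton R M' u') := by
    ext r
    simp only [LinearMap.mem_ker, LinearMap.toSpanSingleton_apply]
    exact ⟨hu.smul_eq_zero_of_isAt hu'.toIsAt, hu'.smul_eq_zero_of_isAt hu.toIsAt⟩
  exact ⟨((LinearMap.quotKerEquivOfSurjective _ hu.toSpanSingleton_surjective).symm.trans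
    (Submodule.quotEquivOfEq _ _ hker)).trans
      (LinearMap.quotKerEquivOfSurjective _ hu'.toSpanSingleton_surjective)⟩

/-- If `x ≠ y`, the idempotent at `y` sends the whole module into its radical, so nothing
concentrated at `y` can generate it. -/
theorem IsInterval.vertex_eq (h : S.IsInterval M x n) (h' : S.IsInterval M y m) (hn : n ≠ 0) :
    x = y := by
  by_contra hxy
  obtain ⟨u, hu⟩ := h
  obtain ⟨v, hv⟩ := h'
  obtain ⟨r, rfl⟩ := Submodule.mem_span_singleton.1 (hu.span_eq_top ▸ Submodule.mem_top : v ∈ _)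
  have hmem : S.w y 0 • r • u ∈ Submodule.span R {S.w x 1 • u} := by
    obtain ⟨a, ha⟩ := exists_smul_eq_sum hu.w_zero_smul r
    rw [ha, Finset.smul_sum]
    refine Submodule.sum_mem _ fun d _ => ?_
    rw [← mul_smul, ← Algebra.commutes, mul_smul]
    refine Submodule.smul_mem _ _ ?_
    rcases Nat.eq_zero_or_pos d with rfl | hd
    · rw [hu.w_zero_smul, w_smul_of_ne hu.w_zero_smul (Ne.symm hxy)]
      exact zero_mem _
    · exact Submodule.smul_mem _ _ (w_smul_mem_span_w_smul x u hd)
  rw [hv.w_zero_smul] at hmem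
  have htop : (⊤ : Submodule R M) ≤ Submodule.span R {S.w x 1 • u} := by
    rw [← hv.span_eq_top]
    exact (Submodule.span_singleton_le_iff_mem _ _).2 hmem
  have := htop (Submodule.mem_top : S.w x 0 • u ∈ _)
  exact hu.w_smul_notMem (by omega) one_pos this

theorem IsInterval.length_unique (h : S.IsInterval M x n) (h' : S.IsInterval M y m) : n = m := by
  have := h.length_eq.symm.trans h'.length_eq
  exact_mod_cast this

end Interval

/-! ### Simple and projective modules -/

section Classification

variable {S} {x y : V} {n : ℕ} {M : Type*} [AddCommGroup M] [Module R M]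

theorem sum_w_smul (m : M) : ∑ x, S.w x 0 • m = m := by
  rw [← Finset.sum_smul, S.sum_w, one_smul]

variable (S) in
theorem exists_w_smul_notMem (X : Submodule R M) {m : M} (hm : m ∉ X) :
    ∃ x, S.w x 0 • m ∉ X := by
  by_contra! h
  exact hm (sum_w_smul (S := S) m ▸ Submodule.sum_mem _ fun x _ => h x)

theorem w_zero_smul_smul (x : V) (m : M) : S.w x 0 • S.w x 0 • m = S.w x 0 • m := by
  rw [← mul_smul, S.w_mul_zero]

variable (S) in
theorem exists_isInterval_of_isSimpleModule (M : Type*) [AddCommGroup M] [Module R M]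
    [hM : IsSimpleModule R M] : ∃ x, S.IsInterval M x 1 := by
  have := IsSimpleModule.nontrivial R M
  obtain ⟨m, hm⟩ := exists_ne (0 : M)
  obtain ⟨x, hx⟩ := S.exists_w_smul_notMem ⊥ (by simpa using hm)
  obtain ⟨n, hn⟩ := S.exists_isAt x (S.w x 0 • m) (w_zero_smul_smul x m)
  have hgen : S.IsInterval M x n := ⟨_, hn, (eq_bot_or_eq_top _).resolve_left (by simpa using hx)⟩
  have h1 := hgen.length_eq
  rw [Module.length_eq_one] at h1
  have : n = 1 := by exact_mod_cast h1.symm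
  subst this
  exact ⟨x, hgen⟩

variable (S) in
theorem isAt_w_zero (x : V) : S.IsAt x (S.c x) (S.w x 0) where
  w_zero_smul := S.w_mul_zero x 0
  w_smul_eq_zero_iff d := by rw [smul_eq_mul, S.w_mul_zero, S.w_eq_zero_iff]

variable (S) in
/-- The projective module generated by the idempotent at `x`. -/
abbrev proj (x : V) : Submodule R R := Submodule.span R {S.w x 0}

variable (S) in
theorem isInterval_proj (x : V) : S.IsInterval (S.proj x) x (S.c x) :=
  (S.isAt_w_zero x).isInterval_span

/-- Right multiplication by `e` retracts `R` onto `R e`. -/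
theorem projective_span_of_isIdempotentElem {R : Type*} [Ring R] {e : R} (he : e * e = e) :
    Module.Projective R (Submodule.span R {e}) := by
  refine Module.Projective.of_split (Submodule.subtype _)
    ((LinearMap.toSpanSingleton R R e).codRestrict _ fun r => Submodule.smul_mem _ _
      (Submodule.mem_span_singleton_self e)) ?_
  ext ⟨r, hr⟩
  obtain ⟨s, rfl⟩ := Submodule.mem_span_singleton.1 hr
  change s * e * e = s * e
  rw [mul_assoc, he]

variable (S) in
theorem projective_proj (x : V) : Module.Projective R (S.proj x) :=
  projective_span_of_isIdempotentElem (S.w_mul_zero x 0)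

theorem IsInterval.finite (h : S.IsInterval M x n) : Module.Finite R M := by
  obtain ⟨u, hu⟩ := h
  exact ⟨⟨{u}, by simpa using hu.span_eq_top⟩⟩

theorem IsInterval.projective (h : S.IsInterval M x (S.c x)) : Module.Projective R M := by
  have := S.projective_proj x
  obtain ⟨e⟩ := (S.isInterval_proj x).nonempty_equiv h
  exact Module.Projective.of_equiv e

variable (S) in
/-- Every finitely generated indecomposable projective module is generated by an idempotent at a
vertex. -/
theorem exists_isInterval_of_projective (M : Type*) [AddCommGroup M] [Module R M]
    [Module.Finite R M] [Module.Projective R M] (hM : IsIndecomposable R M) :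
    ∃ x, S.IsInterval M x (S.c x) := by
  have := hM.1
  obtain ⟨X, hX, -⟩ := (eq_top_or_exists_le_coatom (⊥ : Submodule R M)).resolve_left bot_ne_top
  have := isSimpleModule_iff_isCoatom.2 hX
  obtain ⟨x, hx⟩ := S.exists_isInterval_of_isSimpleModule (M ⧸ X)
  have htop := (S.isInterval_proj x).moduleTop (S.c_pos x).ne'
  obtain ⟨e⟩ := htop.nonempty_equiv hx
  have := S.projective_proj x
  have hgsurj : Function.Surjective
      (e.toLinearMap ∘ₗ (Module.jacobson R (S.proj x)).mkQ) :=
    e.surjective.comp (Submodule.mkQ_surjective _)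
  -- The simple quotient `M ⧸ X` is the top of `proj x`, so projectivity of `M` lifts the quotient
  -- map to `f : M → proj x`. Its range is not contained in the radical, hence is everything.
  obtain ⟨f, hf⟩ := Module.projective_lifting_property _ X.mkQ hgsurj
  have hfsurj : Function.Surjective f := by
    rw [← LinearMap.range_eq_top]
    by_contra hne
    have hle : LinearMap.range f ≤ Module.jacobson R (S.proj x) := by
      obtain ⟨u, hu⟩ := S.isInterval_proj x
      obtain ⟨d, -, hd⟩ := hu.exists_eq_span (LinearMap.range f)
      rw [hd, hu.jacobson_eq]
      refine span_w_smul_anti x u (Nat.one_le_iff_ne_zero.2 ?_)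
      rintro rfl
      exact hne (hd.trans hu.span_w_zero)
    refine hX.1 (eq_top_iff.2 fun m _ => ?_)
    rw [← Submodule.Quotient.mk_eq_zero, ← Submodule.mkQ_apply, ← hf]
    have : (Module.jacobson R (S.proj x)).mkQ (f m) = 0 := by
      rw [Submodule.mkQ_apply, Submodule.Quotient.mk_eq_zero]
      exact hle ⟨m, rfl⟩
    simp [this]
  obtain ⟨g, hg⟩ := Module.projective_lifting_property f LinearMap.id hfsurj
  have hfg (p : S.proj x) : f (g p) = p := LinearMap.congr_fun hg p
  -- As `proj x` is projective, `f` splits; the summand `range g` is nonzero, so indecomposability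
  -- forces `ker f = ⊥`.
  have hcompl : IsCompl (LinearMap.ker f) (LinearMap.range g) := by
    refine ⟨Submodule.disjoint_def.2 ?_, codisjoint_iff.2 (eq_top_iff.2 fun m _ => ?_)⟩
    · rintro _ hm ⟨p, rfl⟩
      rw [LinearMap.mem_ker, hfg] at hm
      rw [hm, map_zero]
    · rw [← sub_add_cancel m (g (f m))]
      exact Submodule.add_mem_sup (by simp [hfg]) ⟨_, rfl⟩
  rcases hM.2 _ _ hcompl with h | h
  · exact ⟨x, (S.isInterval_proj x).of_equiv
      (LinearEquiv.ofBijective f ⟨LinearMap.ker_eq_bot.1 h, hfsurj⟩).symm⟩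
  · rw [LinearMap.range_eq_bot] at h
    exfalso
    obtain ⟨u, hu⟩ := S.isInterval_proj x
    refine (S.c_pos x).ne' (hu.eq_zero_iff.1 ?_)
    rw [← hfg u, h, LinearMap.zero_apply, map_zero]

/-- A nonzero interval module is indecomposable, so if projective it is some `proj y`, and top and
length are invariants. The zero module must be excluded: it is projective, whereas `c x > 0`. -/
theorem IsInterval.projective_iff (h : S.IsInterval M x n) (hn : n ≠ 0) :
    Module.Projective R M ↔ n = S.c x := by
  refine ⟨fun hp => ?_, fun hnx => IsInterval.projective (hnx ▸ h)⟩
  have := h.finite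
  obtain ⟨y, hy⟩ := S.exists_isInterval_of_projective M (h.isIndecomposable hn)
  obtain rfl := h.vertex_eq hy hn
  exact h.length_unique hy

end Classification

end SerialSystem

namespace SerialSystem

variable {k : Type u} [Field k] {R : Type v} [Ring R] [Algebra k R] {V : Type w} [Fintype V]
  (S : SerialSystem k R V)

/-! ### Finitely generated indecomposable modules -/

theorem finite (S : SerialSystem k R V) : Module.Finite k R := by
  classical
  obtain ⟨n, hn⟩ := S.exists_w_eq_zero
  refine ⟨⟨(Finset.univ ×ˢ Finset.range n).image (fun p : V × ℕ => S.w p.1 p.2), ?_⟩⟩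
  rw [eq_top_iff, ← S.span_w, Submodule.span_le]
  rintro _ ⟨⟨x, d⟩, rfl⟩
  by_cases hd : d < n
  · refine Submodule.subset_span ?_
    simp only [Finset.coe_image, Set.mem_image]
    exact ⟨(x, d), by simpa using hd, rfl⟩
  · change S.w x d ∈ _
    rw [S.w_eq_zero_of_le (hn x) (not_lt.1 hd)]
    exact zero_mem _

section Indecomposable

variable {S} {x y : V} {n : ℕ} {M : Type*} [AddCommGroup M] [Module R M] {u : M}

/-- Injectivity of `next` enters here: a path ends at `z` exactly when its extension by one arrow
ends at `next z`. -/
theorem w_one_mul (x z : V) (t : ℕ) :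
    S.w z 1 * S.w x t = S.w (S.next z) 0 * S.w x (t + 1) := by
  by_cases hz : z = S.next^[t] x
  · subst hz
    rw [S.w_mul, ← Function.iterate_succ_apply' (⇑S.next), S.w_zero_mul]
  · rw [S.w_mul_of_ne _ _ _ _ hz, S.w_mul_of_ne]
    rw [Function.iterate_succ_apply']
    exact fun h => hz (S.next.injective h)

/-- Elements of the radical can be divided by an arrow: shorten each path in the expansion by its
last step and cut with the idempotent at `z`. This supplies the correction term when a complement is
enlarged. -/
theorem exists_w_one_smul_eq {z : V} {v : M}
    (hv : v ∈ Submodule.span R {S.w x 1 • u}) (hvz : S.w (S.next z) 0 • v = v) :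
    ∃ u' ∈ Submodule.span R {u}, S.w z 0 • u' = u' ∧ S.w z 1 • u' = v := by
  obtain ⟨r, rfl⟩ := Submodule.mem_span_singleton.1 hv
  have h1 : S.w (S.next x) 0 • S.w x 1 • u = S.w x 1 • u := by
    rw [← mul_smul, ← S.w_zero_mul x 1, Function.iterate_one, ← mul_assoc, S.w_mul_zero]
  obtain ⟨a, ha⟩ := exists_smul_eq_sum h1 r
  refine ⟨S.w z 0 • ∑ d ∈ Finset.range (S.c (S.next x)), algebraMap k R (a d) • S.w x d • u,
    Submodule.smul_mem _ _ (Submodule.sum_mem _ fun d _ => Submodule.smul_mem _ _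
      (Submodule.smul_mem _ _ (Submodule.mem_span_singleton_self u))), w_zero_smul_smul _ _, ?_⟩
  rw [← mul_smul, S.w_mul_zero]
  conv_rhs => rw [← hvz, ha]
  rw [Finset.smul_sum, Finset.smul_sum]
  refine Finset.sum_congr rfl fun d _ => ?_
  have h2 : S.w (S.next x) d • S.w x 1 • u = S.w x (d + 1) • u := by
    rw [← mul_smul, add_comm, ← S.w_mul, Function.iterate_one]
  rw [h2, ← mul_smul, ← mul_smul, ← Algebra.commutes, mul_smul, ← mul_smul _ (algebraMap k R (a d)),
    ← Algebra.commutes, mul_smul, ← mul_smul _ (S.w x d), ← mul_smul _ (S.w x (d + 1)),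
    w_one_mul, mul_assoc,
    mul_smul (algebraMap k R (a d)) (_ * _)]

/-- Follow the paths from a suitable vertex up to the last one that stays outside `X`; the result is
a socle element of `M ⧸ X`. -/
theorem exists_notMem_w_one_smul_mem (X : Submodule R M) (hX : X ≠ ⊤) :
    ∃ (z : V) (v : M), S.w z 0 • v = v ∧ v ∉ X ∧ S.w z 1 • v ∈ X := by
  classical
  obtain ⟨m, -, hm⟩ := SetLike.exists_of_lt (lt_top_iff_ne_top.2 hX)
  obtain ⟨y, hy⟩ := S.exists_w_smul_notMem X hm
  have hex : ∃ d, S.w y d • m ∈ X :=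
    ⟨S.c y, by rw [S.w_eq_zero_iff.2 le_rfl, zero_smul]; exact zero_mem _⟩
  obtain ⟨d, hd⟩ := Nat.exists_eq_succ_of_ne_zero (n := Nat.find hex) fun h0 =>
    hy (by simpa [h0] using Nat.find_spec hex)
  refine ⟨S.next^[d] y, S.w y d • m, ?_, Nat.find_min hex (by omega), ?_⟩
  · rw [← mul_smul, S.w_zero_mul]
  · rw [← mul_smul, S.w_mul, ← Nat.succ_eq_add_one, ← hd]
    exact Nat.find_spec hex

/-- Modulo `W`, every multiple of `v` is a scalar multiple `a 0 • v`. A nonzero scalar would put `v`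
into `W ⊔ U`. -/
theorem disjoint_sup_span {W U : Submodule R M} (hWU : Disjoint W U) {z : V} {v : M}
    (hz : S.w z 0 • v = v) (hv : v ∉ W ⊔ U) (hv1 : S.w z 1 • v ∈ W) :
    Disjoint (W ⊔ Submodule.span R {v}) U := by
  refine Submodule.disjoint_def.2 fun p hp hpU => ?_
  obtain ⟨w, hw, q, hq, rfl⟩ := Submodule.mem_sup.1 hp
  obtain ⟨r, rfl⟩ := Submodule.mem_span_singleton.1 hq
  obtain ⟨a, ha⟩ := exists_smul_eq_sum hz r
  obtain ⟨n, hn⟩ := Nat.exists_eq_add_of_le' (S.c_pos z)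
  rw [hn, Finset.sum_range_succ', hz] at ha
  have hrest : ∑ d ∈ Finset.range n, algebraMap k R (a (d + 1)) • S.w z (d + 1) • v ∈ W := by
    refine Submodule.sum_mem _ fun d _ => Submodule.smul_mem _ _ ?_
    rw [add_comm d, ← S.w_mul, mul_smul]
    exact Submodule.smul_mem _ _ hv1
  by_cases h0 : a 0 = 0
  · refine Submodule.disjoint_def.1 hWU _ (Submodule.add_mem _ hw ?_) hpU
    rw [ha, h0, map_zero, zero_smul, add_zero]
    exact hrest
  · exfalso
    refine hv ?_
    have h1 : algebraMap k R (a 0) • v ∈ W ⊔ U := by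
      have h2 : algebraMap k R (a 0) • v = (w + r • v) -
          (w + ∑ d ∈ Finset.range n, algebraMap k R (a (d + 1)) • S.w z (d + 1) • v) := by
        rw [ha]; abel
      rw [h2]
      exact Submodule.sub_mem _ (Submodule.mem_sup_right hpU)
        (Submodule.mem_sup_left (Submodule.add_mem _ hw hrest))
    have := Submodule.smul_mem _ (algebraMap k R (a 0)⁻¹) h1
    rwa [← mul_smul, ← map_mul, inv_mul_cancel₀ h0, map_one, one_smul] at this

/-- A uniserial submodule of maximal length with respect to all elements concentrated at vertices
is a direct summand. -/
theorem IsAt.exists_isCompl [IsNoetherian R M] (h : S.IsAt x n u)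
    (hmax : ∀ (y : V) (m : ℕ) (v : M), S.IsAt y m v → m ≤ n) :
    ∃ W : Submodule R M, IsCompl W (Submodule.span R {u}) := by
  -- `W` is maximal among the submodules meeting `span {u}` trivially. If the sum is proper, a socle
  -- element `v` modulo the sum is corrected so that it can be added to `W`.
  obtain ⟨W, hW, hWmax⟩ := wellFounded_gt.has_min
    {W : Submodule R M | Disjoint W (Submodule.span R {u})} ⟨⊥, disjoint_bot_left⟩
  refine ⟨W, hW, codisjoint_iff.2 ?_⟩
  by_contra hne
  obtain ⟨z, v, hzv, hv, hv1⟩ := exists_notMem_w_one_smul_mem (S := S) _ hne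
  obtain ⟨w₁, hw₁, u₁, hu₁, hsum⟩ : ∃ w₁ ∈ W, ∃ u₁ ∈ Submodule.span R {u},
      S.w (S.next z) 0 • u₁ = u₁ ∧ w₁ + u₁ = S.w z 1 • v := by
    obtain ⟨w₀, hw₀, u₀, hu₀, h0⟩ := Submodule.mem_sup.1 hv1
    refine ⟨S.w (S.next z) 0 • w₀, Submodule.smul_mem _ _ hw₀, S.w (S.next z) 0 • u₀,
      Submodule.smul_mem _ _ hu₀, w_zero_smul_smul _ _, ?_⟩
    rw [← smul_add, h0, ← mul_smul]
    exact congrArg (· • v) (S.w_zero_mul z 1)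
  obtain ⟨hu₁z, hsum⟩ := hsum
  -- Otherwise `u₁` generates `span {u}` and has the maximal length. Since `v` has at most this
  -- length, the path one arrow shorter sends `u₁` into `W ∩ span {u} = 0`, a contradiction.
  have hmem : u₁ ∈ Submodule.span R {S.w x 1 • u} := by
    by_cases h0 : u₁ = 0
    · rw [h0]; exact zero_mem _
    obtain ⟨d, hdn, hd⟩ := h.exists_span_eq hu₁ h0
    have hu₁d : u₁ ∈ Submodule.span R {S.w x d • u} := hd ▸ Submodule.mem_span_singleton_self u₁
    refine span_w_smul_anti x u (Nat.one_le_iff_ne_zero.2 ?_) hu₁d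
    rintro rfl
    rw [h.w_zero_smul] at hd
    obtain ⟨m, hm⟩ := S.exists_isAt _ u₁ hu₁z
    have hint := hm.isInterval_span
    rw [hd] at hint
    obtain rfl := hint.length_unique h.isInterval_span
    obtain ⟨m', hm'⟩ := S.exists_isAt z v hzv
    have hle := hmax _ _ _ hm'
    have hvm : S.w z m • v = 0 := (hm'.w_smul_eq_zero_iff m).2 hle
    have hm1 : S.w z m = S.w (S.next z) (m - 1) * S.w z 1 := by
      have := S.w_mul z 1 (m - 1)
      rw [Function.iterate_one, Nat.add_sub_cancel' (by omega)] at this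
      exact this.symm
    rw [hm1, mul_smul, ← hsum, smul_add] at hvm
    have hW' : S.w (S.next z) (m - 1) • u₁ ∈ W := by
      rw [← neg_eq_of_add_eq_zero_right hvm]
      exact Submodule.neg_mem _ (Submodule.smul_mem _ _ hw₁)
    have h00 := Submodule.disjoint_def.1 hW _ hW' (Submodule.smul_mem _ _ hu₁)
    rw [hm.w_smul_eq_zero_iff] at h00
    omega
  -- Subtracting `u'` removes the component `u₁`, so the arrow at `z` carries `v - u'` into `W`, and
  -- `W` can be enlarged.
  obtain ⟨u', hu', hzu', hu'1⟩ := exists_w_one_smul_eq hmem hu₁z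
  have hv' : v - u' ∉ W ⊔ Submodule.span R {u} := fun hc => hv (by
    have := Submodule.add_mem _ hc (Submodule.mem_sup_right hu')
    rwa [sub_add_cancel] at this)
  refine hWmax (W ⊔ Submodule.span R {v - u'}) (disjoint_sup_span (S := S) (z := z) hW ?_ hv' ?_) ?_
  · rw [smul_sub, hzv, hzu']
  · rw [smul_sub, hu'1, ← hsum, add_sub_cancel_right]
    exact hw₁
  · refine lt_of_le_of_ne le_sup_left fun he => hv' (Submodule.mem_sup_left ?_)
    rw [he]
    exact Submodule.mem_sup_right (Submodule.mem_span_singleton_self _)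

variable (S) in
/-- Finitely generated indecomposable modules are interval modules. -/
theorem exists_isInterval_of_isIndecomposable (M : Type*) [AddCommGroup M] [Module R M]
    [Module.Finite R M] (hM : IsIndecomposable R M) : ∃ x n, S.IsInterval M x n := by
  have := S.finite
  have : IsNoetherianRing R := IsNoetherianRing.of_finite k R
  have := hM.1
  let s : Set ℕ := {n | ∃ (x : V) (u : M), S.IsAt x n u}
  obtain ⟨m, hm⟩ := exists_ne (0 : M)
  obtain ⟨y, hy⟩ := S.exists_w_smul_notMem ⊥ (by simpa using hm)
  obtain ⟨n₀, hn₀⟩ := S.exists_isAt y (S.w y 0 • m) (w_zero_smul_smul (S := S) y m)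
  have hbdd : BddAbove s := by
    refine ⟨∑ x, S.c x, ?_⟩
    rintro n ⟨x, u, hu⟩
    exact hu.le_c.trans (Finset.single_le_sum (f := S.c) (fun _ _ => Nat.zero_le _)
      (Finset.mem_univ x))
  obtain ⟨x, u, hu⟩ : sSup s ∈ s := Nat.sSup_mem ⟨n₀, y, _, hn₀⟩ hbdd
  obtain ⟨W, hW⟩ := hu.exists_isCompl fun y m v hv => le_csSup hbdd ⟨y, v, hv⟩
  refine ⟨x, sSup s, u, hu, ?_⟩
  rcases hM.2 _ _ hW with h | h
  · simpa [h] using hW.sup_eq_top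
  · exfalso
    have h0 : sSup s = 0 := hu.eq_zero_iff.1 (by simpa using h)
    have h1 := le_csSup hbdd (show n₀ ∈ s from ⟨y, _, hn₀⟩)
    rw [h0, Nat.le_zero] at h1
    exact hy ((Submodule.mem_bot R).2 (hn₀.eq_zero_iff.2 h1))

end Indecomposable

/-! ### Transport of serial systems -/

theorem iterate_reindex {V' : Type*} [Fintype V'] (e : V ≃ V') (x : V') (d : ℕ) :
    (e.symm.trans (S.next.trans e))^[d] x = e (S.next^[d] (e.symm x)) := by
  induction d generalizing x with
  | zero => simp
  | succ d ih =>
    rw [Function.iterate_succ_apply, ih, Function.iterate_succ_apply]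
    simp

/-- Renaming the vertices of a serial system. -/
def reindex {V' : Type*} [Fintype V'] (e : V ≃ V') : SerialSystem k R V' where
  next := e.symm.trans (S.next.trans e)
  w x d := S.w (e.symm x) d
  w_zero_ne x := S.w_zero_ne _
  w_mul x d t := by
    rw [S.iterate_reindex, e.symm_apply_apply, S.w_mul]
  w_mul_of_ne x y d t h := by
    rw [S.iterate_reindex] at h
    exact S.w_mul_of_ne _ _ _ _ fun hy => h (by rw [← hy, e.apply_symm_apply])
  sum_w := (Equiv.sum_comp e.symm fun x => S.w x 0).trans S.sum_w
  exists_w_eq_zero := S.exists_w_eq_zero.imp fun _ h _ => h _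
  span_w := by
    rw [← S.span_w]
    congr 1
    ext r
    constructor
    · rintro ⟨⟨x, d⟩, rfl⟩
      exact ⟨(e.symm x, d), rfl⟩
    · rintro ⟨⟨x, d⟩, rfl⟩
      exact ⟨(e x, d), by simp⟩

theorem c_reindex {V' : Type*} [Fintype V'] (e : V ≃ V') (x : V') :
    (S.reindex e).c x = S.c (e.symm x) :=
  c_eq_of_forall _ fun _ => S.w_eq_zero_iff

theorem iterate_symm_comm (x : V) (d e : ℕ) (h : d ≤ e) :
    S.next^[d] (S.next.symm^[e] x) = S.next.symm^[e - d] x := by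
  obtain ⟨t, rfl⟩ := Nat.exists_eq_add_of_le h
  rw [Function.iterate_add_apply, Nat.add_sub_cancel_left]
  exact (Function.LeftInverse.iterate S.next.apply_symm_apply d) _

/-- The serial system of an algebra that describes its modules of the other side. -/
def unop {A : Type v} [Ring A] [Algebra k A] (S : SerialSystem k Aᵐᵒᵖ V) :
    SerialSystem k A V where
  next := S.next.symm
  -- Read backwards, the path starting at `x` is the old path of the same length ending at `x`.
  w x d := (S.w (S.next.symm^[d] x) d).unop
  w_zero_ne x := by
    rw [Ne, MulOpposite.unop_eq_zero_iff]
    exact S.w_zero_ne x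
  w_mul x d e := by
    rw [← MulOpposite.unop_mul, ← Function.iterate_add_apply, add_comm e d, add_comm d e,
      ← S.w_mul _ e d, S.iterate_symm_comm _ _ _ (Nat.le_add_right e d), Nat.add_sub_cancel_left]
  w_mul_of_ne x y d e h := by
    rw [← MulOpposite.unop_mul, MulOpposite.unop_eq_zero_iff]
    refine S.w_mul_of_ne _ _ _ _ fun h' => h ?_
    rw [h', (Function.LeftInverse.iterate S.next.apply_symm_apply e) y]
  sum_w := by
    refine MulOpposite.op_injective ?_
    rw [MulOpposite.op_one, ← S.sum_w]
    exact map_sum (MulOpposite.opAddEquiv : A ≃+ Aᵐᵒᵖ) _ _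
  exists_w_eq_zero := S.exists_w_eq_zero.imp fun _ h x => by
    rw [MulOpposite.unop_eq_zero_iff]
    exact h _
  span_w := by
    rw [eq_top_iff]
    intro a _
    have ha : MulOpposite.op a ∈
        Submodule.span k (Set.range fun p : V × ℕ => S.w p.1 p.2) := by
      rw [S.span_w]; trivial
    have := Submodule.mem_map_of_mem (f := (MulOpposite.opLinearEquiv k).symm.toLinearMap) ha
    rw [Submodule.map_span] at this
    refine Submodule.span_mono ?_ this
    rintro _ ⟨_, ⟨⟨x, d⟩, rfl⟩, rfl⟩
    refine ⟨(S.next^[d] x, d), ?_⟩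
    change (S.w (S.next.symm^[d] (S.next^[d] x)) d).unop = (S.w x d).unop
    rw [(Function.LeftInverse.iterate S.next.symm_apply_apply d) x]

end SerialSystem

/-! ### Projective dimension -/

theorem hasProjectiveDimensionLT_of_isFiniteLength {R : Type u} [Ring R] {n : ℕ}
    (h : ∀ (M : Type u) [AddCommGroup M] [Module R M], IsSimpleModule R M →
      HasProjectiveDimensionLT (ModuleCat.of R M) n)
    (M : Type u) [AddCommGroup M] [Module R M] (hM : IsFiniteLength R M) :
    HasProjectiveDimensionLT (ModuleCat.of R M) n := by
  induction hM with
  | @of_subsingleton M _ _ _ =>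
    have := (ModuleCat.isZero_of_subsingleton (ModuleCat.of R M)).hasProjectiveDimensionLT_zero
    exact hasProjectiveDimensionLT_of_ge _ 0 n (Nat.zero_le n)
  | @of_simple_quotient M _ _ X hs _ ih =>
    -- Allows replacing `X` by the propositionally equal kernel of the quotient map in the short
    -- exact sequence.
    have hX : ∀ Y : Submodule R M, Y = X → HasProjectiveDimensionLT (ModuleCat.of R Y) n := by
      rintro _ rfl
      exact ih
    exact (LinearMap.shortExact_shortComplexKer
      (Submodule.mkQ_surjective X)).hasProjectiveDimensionLT_X₂ n
        (hX _ (Submodule.ker_mkQ X)) (h (M ⧸ X) hs)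

namespace SerialSystem

variable {k : Type w} [Field k] {R : Type u} [Ring R] [Algebra k R] {V : Type v} [Fintype V]
  (S : SerialSystem k R V)

/-- The top and the length of the first syzygy of an interval module. -/
def syz (p : V × ℕ) : V × ℕ := (S.next^[p.2] p.1, S.c p.1 - p.2)

variable {S} {x : V} {n : ℕ} {M : Type u} [AddCommGroup M] [Module R M]

/-- The kernel of the cover is generated by a path, like every submodule of `proj x`; comparing
lengths shows that this path has length `n`. -/
theorem IsInterval.exists_syzygy (h : S.IsInterval M x n) :
    ∃ f : S.proj x →ₗ[R] M, Function.Surjective f ∧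
      S.IsInterval (LinearMap.ker f) (S.next^[n] x) (S.c x - n) := by
  obtain ⟨u, hu⟩ := h
  have hg := (S.isAt_w_zero x).isGen_span
  set g : S.proj x := ⟨S.w x 0, Submodule.mem_span_singleton_self _⟩
  set f : S.proj x →ₗ[R] M := (LinearMap.toSpanSingleton R M u).domRestrict (S.proj x)
  have hf : Function.Surjective f := by
    rw [← LinearMap.range_eq_top, eq_top_iff, ← hu.span_eq_top,
      Submodule.span_singleton_le_iff_mem]
    exact ⟨g, hu.w_zero_smul⟩
  obtain ⟨d, hd, hker⟩ := hg.exists_eq_span (LinearMap.ker f)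
  have hq : S.IsInterval (S.proj x ⧸ LinearMap.ker f) x d := by
    rw [hker]
    exact ⟨_, hg.quotient hd⟩
  obtain rfl := (hq.of_equiv (f.quotKerEquivOfSurjective hf)).length_unique ⟨u, hu⟩
  refine ⟨f, hf, ?_⟩
  rw [hker]
  exact (hg.w_smul d).isInterval_span

/-- Dimension shifting along the covers `proj x → M`. An earlier zero in the orbit does no harm:
`syz (x, 0) = (x, c x)` still describes the kernel of `proj x → 0`. -/
theorem IsInterval.hasProjectiveDimensionLT (K : ℕ) {M : Type u} [AddCommGroup M] [Module R M]
    (h : S.IsInterval M x n) (hK : (S.syz^[K] (x, n)).2 = 0) :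
    HasProjectiveDimensionLT (ModuleCat.of R M) K := by
  induction K generalizing x n M with
  | zero =>
    have := h.subsingleton_iff.2 hK
    exact (ModuleCat.isZero_of_subsingleton (ModuleCat.of R M)).hasProjectiveDimensionLT_zero
  | succ K ih =>
    obtain ⟨f, hf, hker⟩ := h.exists_syzygy
    have hp : Projective (ModuleCat.of R (S.proj x)) :=
      (IsProjective.iff_projective _).1 (S.projective_proj x)
    exact (LinearMap.shortExact_shortComplexKer hf).hasProjectiveDimensionLT_X₃ K (ih hker hK)
      (hasProjectiveDimensionLT_of_ge _ 1 _ (by omega))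

theorem IsInterval.not_hasProjectiveDimensionLT (h : S.IsInterval M x n)
    (hn : ∀ K, (S.syz^[K] (x, n)).2 ≠ 0) (K : ℕ) :
    ¬ HasProjectiveDimensionLT (ModuleCat.of R M) K := by
  induction K generalizing x n M with
  | zero =>
    rw [hasProjectiveDimensionLT_zero_iff_isZero, ModuleCat.isZero_iff_subsingleton]
    exact fun hs => hn 0 (h.subsingleton_iff.1 hs)
  | succ K ih =>
    intro hpd
    -- Dimension shifting along a projective cover term needs a bound of at least `1`, so bound one
    -- is treated apart: then the module is projective and its first syzygy is already zero.
    rcases K with _ | K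
    · have hp := (IsProjective.iff_projective _).2
        (projective_iff_hasProjectiveDimensionLT_one.2 hpd)
      have hnc := (h.projective_iff (hn 0)).1 hp
      exact hn 1 (by simp [syz, hnc])
    · obtain ⟨f, hf, hker⟩ := h.exists_syzygy
      have hp : Projective (ModuleCat.of R (S.proj x)) :=
        (IsProjective.iff_projective _).1 (S.projective_proj x)
      exact ih hker (fun K => hn (K + 1))
        ((LinearMap.shortExact_shortComplexKer hf).hasProjectiveDimensionLT_X₁ (K + 1)
          (hasProjectiveDimensionLT_of_ge _ 1 _ (by omega)) hpd)

/-! ### Global dimension and orbits of the syzygy map -/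

section GlobalDimension

variable {A : Type u} [Ring A] [Algebra k A] (S : SerialSystem k Aᵐᵒᵖ V)

/-- If the syzygies of every simple reached zero, finitely many simples would give a common bound,
which passes to all modules of finite length, that is to all finitely generated ones. -/
theorem exists_syz_ne_zero_of_rightGlobalDimension_eq_top (h : rightGlobalDimension A = ⊤) :
    ∃ x, ∀ K, (S.syz^[K] (x, 1)).2 ≠ 0 := by
  by_contra! hcon
  choose K hK using hcon
  have hbound (x : V) : K x ≤ ∑ x, K x :=
    Finset.single_le_sum (fun _ _ => Nat.zero_le _) (Finset.mem_univ x)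
  have hsimple (M : Type u) [AddCommGroup M] [Module Aᵐᵒᵖ M] (_ : IsSimpleModule Aᵐᵒᵖ M) :
      HasProjectiveDimensionLT (ModuleCat.of Aᵐᵒᵖ M) (∑ x, K x) := by
    obtain ⟨x, hx⟩ := S.exists_isInterval_of_isSimpleModule M
    have := hx.hasProjectiveDimensionLT (K x) (hK x)
    exact hasProjectiveDimensionLT_of_ge _ (K x) _ (hbound x)
  have hle : rightGlobalDimension A ≤ ((∑ x, K x : ℕ) : WithBot ℕ∞) := by
    refine iSup_le fun M => iSup_le fun hM => ?_
    have := S.finite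
    have : IsArtinianRing Aᵐᵒᵖ := IsArtinianRing.of_finite k Aᵐᵒᵖ
    have hfl : IsFiniteLength Aᵐᵒᵖ M :=
      isFiniteLength_iff_isNoetherian_isArtinian.2 ⟨inferInstance, inferInstance⟩
    have := hasProjectiveDimensionLT_of_isFiniteLength hsimple M hfl
    rw [projectiveDimension_le_iff]
    exact hasProjectiveDimensionLT_of_ge (ModuleCat.of Aᵐᵒᵖ M) (∑ x, K x) _ (by omega)
  rw [h, top_le_iff] at hle
  exact absurd hle (by
    rw [← WithBot.coe_natCast, ← WithBot.coe_top, WithBot.coe_inj]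
    exact ENat.natCast_ne_top _)

theorem rightGlobalDimension_eq_top {x : V} {n : ℕ} (hnc : n ≤ S.c x)
    (h : ∀ K, (S.syz^[K] (x, n)).2 ≠ 0) : rightGlobalDimension A = ⊤ := by
  have hg := (S.isAt_w_zero x).isGen_span
  have hint := hg.quotient hnc
  have hfin := IsInterval.finite ⟨_, hint⟩
  refine top_le_iff.1 (le_trans ?_ (le_iSup₂ (ModuleCat.of Aᵐᵒᵖ (S.proj x ⧸ _)) hfin))
  rw [top_le_iff]
  by_contra hne
  obtain ⟨K, hK⟩ := (projectiveDimension_ne_top_iff _).1 hne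
  exact IsInterval.not_hasProjectiveDimensionLT ⟨_, hint⟩ h _ hK

end GlobalDimension

/-! ### Infinite syzygy chains exclude sinks -/

section InfiniteSyzygies

variable (S) {x : V} {n : ℕ}

theorem c_le_add (x : V) (d : ℕ) : S.c x ≤ d + S.c (S.next^[d] x) := by
  induction d generalizing x with
  | zero => simp
  | succ d ih =>
    have h1 := S.c_le x
    have h2 := ih (S.next x)
    rw [Function.iterate_succ_apply]
    omega

/-- If some module has infinitely many nonzero syzygies and the quiver is connected, then no vertex
is a sink. -/
theorem two_le_c (hx : ∀ y, ∃ d, S.next^[d] x = y) (hnc : n ≤ S.c x)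
    (h : ∀ K, (S.syz^[K] (x, n)).2 ≠ 0) (y : V) : 2 ≤ S.c y := by
  by_contra! hlt
  obtain ⟨q, rfl⟩ := hx y
  -- Unrolls the cycle: `p K` is the number of steps from `x` to the top of the `K`-th syzygy. Two
  -- consecutive syzygy lengths add up to a projective length, whence `hp2`.
  set p : ℕ → ℕ := fun K => ∑ j ∈ Finset.range K, (S.syz^[j] (x, n)).2
  have hp1 (K : ℕ) : p (K + 1) = p K + (S.syz^[K] (x, n)).2 := Finset.sum_range_succ _ K
  have hpos (K : ℕ) : S.next^[p K] x = (S.syz^[K] (x, n)).1 := by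
    induction K with
    | zero => rfl
    | succ K ih =>
      rw [hp1, add_comm, Function.iterate_add_apply, ih, Function.iterate_succ_apply']
      rfl
  have hle (K : ℕ) : (S.syz^[K] (x, n)).2 ≤ S.c (S.syz^[K] (x, n)).1 := by
    rcases K with _ | K
    · exact hnc
    · have h1 := S.c_le_add (S.syz^[K] (x, n)).1 (S.syz^[K] (x, n)).2
      rw [Function.iterate_succ_apply']
      exact Nat.sub_le_iff_le_add'.2 h1
  have hp2 (K : ℕ) : p (K + 2) = p K + S.c (S.next^[p K] x) := by
    have h1 : (S.syz^[K + 1] (x, n)).2 = S.c (S.syz^[K] (x, n)).1 - (S.syz^[K] (x, n)).2 := by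
      rw [Function.iterate_succ_apply']
      rfl
    have h2 := hle K
    rw [hp1, hp1, h1, hpos]
    omega
  have hmono : StrictMono p := strictMono_nat_of_lt_succ fun K => by
    have := h K
    rw [hp1]
    omega
  obtain ⟨K, hK1, hK2⟩ : ∃ K, p K ≤ q ∧ q < p (K + 1) := by
    have hex : ∃ K, q < p K := ⟨q + 1, (Nat.lt_succ_self q).trans_le (hmono.le_apply)⟩
    classical
    obtain ⟨K, hK⟩ := Nat.exists_eq_succ_of_ne_zero (n := Nat.find hex) fun h0 => by
      have := Nat.find_spec hex
      rw [h0] at this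
      exact Nat.not_lt_zero _ this
    have h1 := Nat.find_min hex (m := K) (by omega)
    have h2 := Nat.find_spec hex
    rw [hK] at h2
    exact ⟨K, not_lt.1 h1, h2⟩
  -- With `q = p K + t` and `c = 1` at that vertex, the projective at `p K` has length at most `t +
  -- 1`. So `p (K + 2) ≤ q + 1 ≤ p (K + 1)`, against strict monotonicity.
  obtain ⟨t, rfl⟩ := Nat.exists_eq_add_of_le hK1
  have h1 := S.c_le_add (S.next^[p K] x) t
  rw [← Function.iterate_add_apply, add_comm t (p K)] at h1
  have h2 := hp2 K
  have h3 := hmono (Nat.lt_succ_self (K + 1))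
  simp only [Nat.succ_eq_add_one, add_assoc, one_add_one_eq_two] at h3
  omega

end InfiniteSyzygies

end SerialSystem

/-- In a quiver in which no vertex is the source of two arrows, a path is determined by its source
and its length. -/
theorem path_eq_of_length_eq {V : Type v} [Quiver.{w} V]
    (hsub : ∀ x y : V, Subsingleton (x ⟶ y))
    (harr : ∀ x y z : V, (x ⟶ y) → (x ⟶ z) → y = z) {x y z : V}
    (p : Quiver.Path x y) (q : Quiver.Path x z) (h : p.length = q.length) :
    (⟨x, y, p⟩ : AllPaths V) = ⟨x, z, q⟩ := by
  induction p generalizing z with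
  | nil =>
    cases q with
    | nil => rfl
    | cons q e => simp at h
  | cons p e ih =>
    cases q with
    | nil => simp at h
    | cons q e' =>
      have := ih q (by simpa using h)
      obtain ⟨rfl, h2⟩ := Sigma.mk.inj (eq_of_heq (Sigma.mk.inj this).2)
      obtain rfl := eq_of_heq h2
      obtain rfl := harr _ _ _ e e'
      rw [(hsub _ _).elim e e']

/-! ### Homomorphisms from bound quiver algebras -/

namespace PathAlgebra

variable (k : Type u) [Field k] {V : Type v} [Quiver.{w} V] {A : Type*} [Ring A] [Algebra k A]

/-- The linear extension of a map on paths. -/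
def liftLinear (f : AllPaths V → A) : PathAlgebra k V →ₗ[k] A := Finsupp.linearCombination k f

@[simp]
theorem liftLinear_ofPath (f : AllPaths V → A) (p : AllPaths V) :
    liftLinear k f (ofPath k p) = f p := by
  change Finsupp.linearCombination k f (Finsupp.single p 1) = f p
  simp

/-- The algebra homomorphism given by a multiplicative map on paths. -/
def lift [Fintype V] (f : AllPaths V → A)
    (hmul : ∀ (x y z : V) (p : Quiver.Path x y) (q : Quiver.Path y z),
      f ⟨x, z, p.comp q⟩ = f ⟨x, y, p⟩ * f ⟨y, z, q⟩)
    (hzero : ∀ p q : AllPaths V, p.2.1 ≠ q.1 → f p * f q = 0)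
    (hone : ∑ x : V, f ⟨x, x, Quiver.Path.nil⟩ = 1) : PathAlgebra k V →ₐ[k] A :=
  AlgHom.ofLinearMap (liftLinear k f) (by simp [one_def, hone]) (by
    have h1 (p q : AllPaths V) :
        liftLinear k f (ofPath k p * ofPath k q) = f p * f q := by
      obtain ⟨x, y, p⟩ := p
      obtain ⟨y', z, q⟩ := q
      by_cases h : y = y'
      · subst h
        rw [ofPath_mul_comp, liftLinear_ofPath, hmul]
      · rw [ofPath_mul_of_ne k _ _ (by exact h), map_zero, hzero _ _ (by exact h)]
    have h2 (p : AllPaths V) (b : PathAlgebra k V) :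
        liftLinear k f (ofPath k p * b) = f p * liftLinear k f b :=
      LinearMap.congr_fun (f := (liftLinear k f) ∘ₗ mulHom k (ofPath k p))
        (g := LinearMap.mulLeft k (f p) ∘ₗ liftLinear k f)
        (lhom_ext k fun q => by simpa [mul_def] using h1 p q) b
    intro a b
    exact LinearMap.congr_fun (f := (liftLinear k f) ∘ₗ (mulHom k).flip b)
        (g := LinearMap.mulRight k (liftLinear k f b) ∘ₗ liftLinear k f)
        (lhom_ext k fun p => by simpa [mul_def] using h2 p b) a)

theorem lift_ofPath [Fintype V] (f : AllPaths V → A) (hmul hzero hone) (p : AllPaths V) :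
    lift k f hmul hzero hone (ofPath k p) = f p :=
  liftLinear_ofPath k f p

theorem span_ofPath : Submodule.span k (Set.range (ofPath k (V := V))) = ⊤ := by
  rw [← Submodule.ker_mkQ (Submodule.span k _), LinearMap.ker_eq_top]
  refine lhom_ext k fun p => ?_
  rw [LinearMap.zero_apply, Submodule.mkQ_apply, Submodule.Quotient.mk_eq_zero]
  exact Submodule.subset_span ⟨p, rfl⟩

end PathAlgebra

namespace BoundQuiverAlgebra

variable (k : Type u) [Field k] {V : Type v} [Quiver.{w} V] [Fintype V] (R : Set (AllPaths V))

theorem path_mul_path {x y z : V} (p : Quiver.Path x y) (q : Quiver.Path y z) :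
    path k R ⟨x, y, p⟩ * path k R ⟨y, z, q⟩ = path k R ⟨x, z, p.comp q⟩ := by
  rw [path, path, path, ← map_mul, PathAlgebra.ofPath_mul_comp]

theorem path_mul_path_of_ne (p q : AllPaths V) (h : p.2.1 ≠ q.1) :
    path k R p * path k R q = 0 := by
  rw [path, path, ← map_mul, PathAlgebra.ofPath_mul_of_ne k _ _ h, map_zero]

theorem sum_path_nil : ∑ x : V, path k R ⟨x, x, Quiver.Path.nil⟩ = 1 := by
  simp only [path]
  rw [← map_sum, ← PathAlgebra.one_def, map_one]

variable {R} in
theorem path_eq_zero {p : AllPaths V} (hp : p ∈ R) : path k R p = 0 :=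
  (RingQuot.mkAlgHom_rel k (PathRel.zero p hp)).trans (map_zero _)

theorem span_path : Submodule.span k (Set.range (path k R)) = ⊤ := by
  have h := congrArg (Submodule.map (mk k R).toLinearMap) (PathAlgebra.span_ofPath k (V := V))
  rw [Submodule.map_span, ← Set.range_comp, Submodule.map_top,
    LinearMap.range_eq_top.2 (RingQuot.mkAlgHom_surjective k (PathRel k R))] at h
  exact h

/-- The algebra homomorphism given by a multiplicative map on paths that respects the relations. -/
def lift {A : Type*} [Ring A] [Algebra k A] (f : PathAlgebra k V →ₐ[k] A)
    (hf : ∀ p ∈ R, f (PathAlgebra.ofPath k p) = 0) : BoundQuiverAlgebra k V R →ₐ[k] A :=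
  RingQuot.liftAlgHom k ⟨f, fun a b h => by
    obtain ⟨p, hp⟩ := h
    rw [hf p hp, map_zero]⟩

theorem lift_path {A : Type*} [Ring A] [Algebra k A] (f : PathAlgebra k V →ₐ[k] A)
    (hf : ∀ p ∈ R, f (PathAlgebra.ofPath k p) = 0) (p : AllPaths V) :
    lift k R f hf (path k R p) = f (PathAlgebra.ofPath k p) :=
  RingQuot.liftAlgHom_mkAlgHom_apply _ _ _ _

end BoundQuiverAlgebra

namespace SerialSystem

/-! ### Linear independence of the nonzero paths -/

section Independence

variable {k : Type u} [Field k] {R : Type v} [Ring R] [Algebra k R] {V : Type w} [Fintype V]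
  (S : SerialSystem k R V)

theorem linearIndependent_w :
    LinearIndependent k fun i : Σ x : V, Fin (S.c x) => S.w i.1 i.2 := by
  classical
  rw [Fintype.linearIndependent_iff]
  rintro g hg ⟨x, d⟩
  rw [Fintype.sum_sigma] at hg
  have h := congrArg (· * S.w x 0) hg
  simp only [Finset.sum_mul, zero_mul] at h
  rw [Finset.sum_eq_single x] at h
  · have h' : ∑ e ∈ Finset.range (S.c x), algebraMap k R
        (if he : e < S.c x then g ⟨x, e, he⟩ else 0) • S.w x e • S.w x 0 = 0 := by
      rw [← h, Finset.sum_range]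
      refine Finset.sum_congr rfl fun e _ => ?_
      simp [Algebra.smul_def, mul_assoc]
    have := (S.isAt_w_zero x).coeff_eq_zero h' (Finset.mem_range.2 d.2) d.2
    simpa using this
  · intro y _ hy
    exact Finset.sum_eq_zero fun e _ => by rw [smul_mul_assoc, S.w_mul_zero_of_ne hy, smul_zero]
  · simp

end Independence

/-! ### Presentation of serial algebras by quivers and relations -/

section Presentation

variable {k : Type u} [Field k] {A : Type v} [Ring A] [Algebra k A] {V : Type w} [Fintype V]
  [Quiver.{0} V] {S : SerialSystem k Aᵐᵒᵖ V}

theorem target_eq (harr : ∀ x y : V, Nonempty (x ⟶ y) → y = S.next x) {x y : V}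
    (p : Quiver.Path x y) : y = S.next^[p.length] x := by
  induction p with
  | nil => rfl
  | cons p e ih => rw [Quiver.Path.length_cons, Function.iterate_succ_apply', ← ih, harr _ _ ⟨e⟩]

/-- Since `c` drops by at most one per step, it is still at least `2` after `d` steps whenever `d +
1 < c x`, so a further arrow is available. -/
theorem exists_path (harr : ∀ x : V, 2 ≤ S.c x → Nonempty (x ⟶ S.next x)) (x : V) (d : ℕ)
    (hd : d < S.c x) : ∃ (y : V) (p : Quiver.Path x y), p.length = d ∧ y = S.next^[d] x := by
  induction d with
  | zero => exact ⟨x, .nil, rfl, rfl⟩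
  | succ d ih =>
    obtain ⟨y, p, hp, rfl⟩ := ih (by omega)
    have := S.c_le_add x d
    obtain ⟨e⟩ := harr (S.next^[d] x) (by omega)
    exact ⟨_, p.cons e, by simp [hp], (Function.iterate_succ_apply' _ _ _).symm⟩

theorem two_le_c_of_path (harr : ∀ x y : V, Nonempty (x ⟶ y) → 2 ≤ S.c x) {x y : V}
    (p : Quiver.Path x y) (hp : p.length ≠ 0) : 2 ≤ S.c x := by
  induction p with
  | nil => exact absurd rfl hp
  | cons p e ih =>
    by_cases h : p.length = 0
    · obtain rfl := Quiver.Path.eq_of_length_zero p h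
      exact harr _ _ ⟨e⟩
    · exact ih h

/-- If `c x ≤ c (next x)`, the initial segment of length `c x` is a relation. Otherwise `c (next x)
< c x`, and the path without its first arrow already vanishes by induction on the length. -/
theorem path_eq_zero {rel : Set (AllPaths V)}
    (harr : ∀ x y : V, Nonempty (x ⟶ y) → 2 ≤ S.c x ∧ y = S.next x)
    (hrel : ∀ p : AllPaths V, p.2.2.length = S.c p.1 → 2 ≤ S.c p.1 →
      S.c p.1 ≤ S.c (S.next p.1) → p ∈ rel)
    {x y : V} (p : Quiver.Path x y) (hp : S.c x ≤ p.length) :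
    BoundQuiverAlgebra.path k rel ⟨x, y, p⟩ = 0 := by
  induction hl : p.length generalizing x with
  | zero =>
    have := S.c_pos x
    omega
  | succ l ih =>
    by_cases h : S.c x ≤ S.c (S.next x)
    · obtain ⟨z, p₁, p₂, rfl, h1⟩ := p.exists_eq_comp_of_le_length hp
      rw [← BoundQuiverAlgebra.path_mul_path, BoundQuiverAlgebra.path_eq_zero, zero_mul]
      refine hrel _ h1 ?_ h
      exact two_le_c_of_path (fun x y h => (harr x y h).1) p₁ (by rw [h1]; exact (S.c_pos x).ne')
    · obtain ⟨z, p₁, p₂, rfl, h1⟩ := p.exists_eq_comp_of_le_length (n := 1) (by omega)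
      have hz := target_eq (S := S) (fun x y h => (harr x y h).2) p₁
      rw [h1, Function.iterate_one] at hz
      subst hz
      rw [Quiver.Path.length_comp, h1] at hl hp
      rw [← BoundQuiverAlgebra.path_mul_path, ih p₂ (by omega) (by omega), mul_zero]

/-- An algebra with a serial system is given by a quiver and monomial relations. -/
theorem nonempty_algEquiv (rel : Set (AllPaths V)) (hsub : ∀ x y : V, Subsingleton (x ⟶ y))
    (harr : ∀ x y : V, Nonempty (x ⟶ y) ↔ 2 ≤ S.c x ∧ y = S.next x)
    (hrel : ∀ p : AllPaths V, p ∈ rel ↔ p.2.2.length = S.c p.1 ∧ 2 ≤ S.c p.1 ∧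
      S.c p.1 ≤ S.c (S.next p.1)) :
    Nonempty (A ≃ₐ[k] BoundQuiverAlgebra k V rel) := by
  have harr₁ : ∀ x y : V, Nonempty (x ⟶ y) → y = S.next x := fun x y h => ((harr x y).1 h).2
  -- Passing from `Aᵐᵒᵖ` to `A` turns function-style composition into left-to-right concatenation.
  let f : AllPaths V → A := fun p => (S.w p.1 p.2.2.length).unop
  let F : PathAlgebra k V →ₐ[k] A := PathAlgebra.lift k f
    (fun x y z p q => by
      change (S.w x (p.comp q).length).unop = (S.w x p.length).unop * (S.w y q.length).unop
      have h := S.w_mul x p.length q.length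
      rw [← target_eq harr₁ p] at h
      rw [← MulOpposite.unop_mul, Quiver.Path.length_comp, h])
    (fun p q h => by
      rw [← MulOpposite.unop_mul, S.w_mul_of_ne, MulOpposite.unop_zero]
      exact fun h' => h ((target_eq harr₁ p.2.2).trans h'.symm))
    (by
      refine MulOpposite.op_injective ?_
      rw [MulOpposite.op_one, ← S.sum_w]
      exact map_sum (MulOpposite.opAddEquiv : A ≃+ Aᵐᵒᵖ) _ _)
  have hF (p : AllPaths V) : F (PathAlgebra.ofPath k p) = (S.w p.1 p.2.2.length).unop :=
    PathAlgebra.lift_ofPath k f _ _ _ p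
  let G : BoundQuiverAlgebra k V rel →ₐ[k] A := BoundQuiverAlgebra.lift k rel F fun p hp => by
    rw [hF, S.w_eq_zero_iff.2 ((hrel p).1 hp).1.ge, MulOpposite.unop_zero]
  have hG (p : AllPaths V) :
      G (BoundQuiverAlgebra.path k rel p) = (S.w p.1 p.2.2.length).unop :=
    (BoundQuiverAlgebra.lift_path k rel F _ p).trans (hF p)
  choose y q hq hy using exists_path (S := S) (fun x hx => (harr x _).2 ⟨hx, rfl⟩)
  -- One path for each source and each nonvanishing length. These classes span the bound quiver
  -- algebra and have independent images, so `G` is injective.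
  let b : (Σ x : V, Fin (S.c x)) → BoundQuiverAlgebra k V rel := fun i =>
    BoundQuiverAlgebra.path k rel ⟨i.1, y i.1 i.2 i.2.2, q i.1 i.2 i.2.2⟩
  have hGb (i) : G (b i) = (S.w i.1 i.2).unop := by rw [hG, hq]
  have hli : LinearIndependent k fun i => G (b i) := by
    simp only [hGb]
    exact S.linearIndependent_w.map' (MulOpposite.opLinearEquiv k).symm.toLinearMap
      (LinearEquiv.ker _)
  have hbspan : Submodule.span k (Set.range b) = ⊤ := by
    rw [eq_top_iff, ← BoundQuiverAlgebra.span_path, Submodule.span_le]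
    rintro _ ⟨⟨x, z, p⟩, rfl⟩
    by_cases hp : p.length < S.c x
    · refine Submodule.subset_span ⟨⟨x, p.length, hp⟩, ?_⟩
      change BoundQuiverAlgebra.path k rel _ = _
      rw [path_eq_of_length_eq hsub
        (fun x y z e e' => (harr₁ _ _ ⟨e⟩).trans (harr₁ _ _ ⟨e'⟩).symm) (q x p.length hp) p (hq _ _ _)]
    · rw [path_eq_zero (S := S) (fun x y => (harr x y).1)
        (fun p h1 h2 h3 => (hrel p).2 ⟨h1, h2, h3⟩)
        p (not_lt.1 hp)]
      exact zero_mem _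
  have hGinj : Function.Injective G := by
    rw [injective_iff_map_eq_zero]
    intro a ha
    obtain ⟨g, rfl⟩ : a ∈ Set.range (Fintype.linearCombination k b) := by
      rw [← LinearMap.coe_range, Fintype.range_linearCombination, hbspan]
      trivial
    rw [Fintype.linearCombination_apply, map_sum] at ha
    simp only [map_smul] at ha
    have := Fintype.linearIndependent_iff.1 hli g ha
    rw [Fintype.linearCombination_apply]
    exact Finset.sum_eq_zero fun i _ => by rw [this i, zero_smul]
  have hGsurj : Function.Surjective G := by
    intro a
    have ha : MulOpposite.op a ∈ Submodule.span k (Set.range fun p : V × ℕ => S.w p.1 p.2) := by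
      rw [S.span_w]; trivial
    suffices h : Submodule.span k (Set.range fun p : V × ℕ => S.w p.1 p.2) ≤
        (LinearMap.range G.toLinearMap).map (MulOpposite.opLinearEquiv k).toLinearMap by
      obtain ⟨_, ⟨z, rfl⟩, hz⟩ := h ha
      exact ⟨z, MulOpposite.op_injective hz⟩
    rw [Submodule.span_le]
    rintro _ ⟨⟨x, d⟩, rfl⟩
    by_cases hd : d < S.c x
    · refine ⟨_, ⟨b ⟨x, d, hd⟩, rfl⟩, ?_⟩
      exact congrArg MulOpposite.op (hGb ⟨x, d, hd⟩)
    · change S.w x d ∈ _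
      rw [S.w_eq_zero_iff.2 (not_lt.1 hd)]
      exact zero_mem _
  exact ⟨(AlgEquiv.ofBijective G ⟨hGinj, hGsurj⟩).symm⟩

end Presentation

end SerialSystem

/-! ### The serial system of a cyclic Nakayama algebra -/

section CyclicWalk

variable {N : ℕ}

theorem cyclicWalk_fst (x : CyclicVertex N) (d : ℕ) :
    (cyclicWalk x d).1 = x + (d : CyclicVertex N) := by
  induction d with
  | zero => simp [cyclicWalk]
  | succ d ih => simp [cyclicWalk, ih, add_assoc]

theorem length_cyclicWalk (x : CyclicVertex N) (d : ℕ) : (cyclicWalk x d).2.length = d := by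
  induction d with
  | zero => rfl
  | succ d ih => simp [cyclicWalk, ih]

theorem CyclicVertex.subsingleton_hom (x y : CyclicVertex N) : Subsingleton (x ⟶ y) :=
  inferInstanceAs (Subsingleton (PLift (y = x + 1)))

theorem CyclicVertex.path_eq (p : AllPaths (CyclicVertex N)) :
    p = ⟨p.1, cyclicWalk p.1 p.2.2.length⟩ :=
  path_eq_of_length_eq CyclicVertex.subsingleton_hom
    (fun _ _ _ (e : PLift _) (e' : PLift _) => e.down.trans e'.down.symm) _ _
    (length_cyclicWalk _ _).symm

theorem CyclicVertex.target_eq {x y : CyclicVertex N} (p : Quiver.Path x y) :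
    y = x + (p.length : CyclicVertex N) :=
  (congrArg (fun p : AllPaths (CyclicVertex N) => p.2.1) (CyclicVertex.path_eq ⟨x, y, p⟩)).trans
    (cyclicWalk_fst _ _)

theorem iterate_add_one (x : CyclicVertex N) (d : ℕ) :
    (Equiv.addRight (1 : CyclicVertex N))^[d] x = x + (d : CyclicVertex N) := by
  induction d with
  | zero => simp
  | succ d ih => rw [Function.iterate_succ_apply', ih]; simp [add_assoc]

end CyclicWalk

namespace CyclicRelations

variable {N : ℕ} (D : CyclicRelations N) (k : Type u) [Field k]

/-- The path of length `d` that starts at `x` contains a relation. -/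
def HasRel (x : CyclicVertex N) (d : ℕ) : Prop :=
  ∃ ρ ∈ D.rel, ∃ t : ℕ, ρ.1 = x + (t : CyclicVertex N) ∧ t + ρ.2 ≤ d

variable {D}

theorem HasRel.mono {x : CyclicVertex N} {d e : ℕ} (h : D.HasRel x d) (hde : d ≤ e) :
    D.HasRel x e := by
  obtain ⟨ρ, hρ, t, ht, hle⟩ := h
  exact ⟨ρ, hρ, t, ht, hle.trans hde⟩

variable (D)

theorem not_hasRel_zero (x : CyclicVertex N) : ¬ D.HasRel x 0 := by
  rintro ⟨ρ, hρ, t, -, h⟩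
  have := D.two_le ρ hρ
  omega

/-- Of two relations ending at the same vertex the shorter is a subpath of the longer, so
irredundancy makes them equal. -/
theorem card_syzVertices : D.syzVertices.card = D.rel.card := by
  rw [syzVertices, socleVertices, Finset.image_image]
  refine Finset.card_image_of_injOn ?_
  have key : ∀ ρ ∈ D.rel, ∀ σ ∈ D.rel, ρ.2 ≤ σ.2 →
      ρ.1 + (ρ.2 : CyclicVertex N) = σ.1 + (σ.2 : CyclicVertex N) → ρ = σ := by
    intro ρ hρ σ hσ hle h
    refine D.irredundant ρ hρ σ hσ ⟨σ.2 - ρ.2, ?_, by omega⟩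
    rw [Nat.cast_sub hle, ← add_sub_assoc, ← h, add_sub_cancel_right]
  intro ρ hρ σ hσ h
  have h' : ρ.1 + (ρ.2 : CyclicVertex N) = σ.1 + (σ.2 : CyclicVertex N) := by
    simpa using h
  rcases le_total ρ.2 σ.2 with hle | hle
  · exact key ρ hρ σ hσ hle h'
  · exact (key σ hσ ρ hρ hle h'.symm).symm

open Classical in
/-- The action of a path on the functions on the set of all paths that contain no relation. -/
def pathAction (p : AllPaths (CyclicVertex N)) :
    Module.End k ({i : CyclicVertex N × ℕ // ¬ D.HasRel i.1 i.2} → k) where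
  toFun φ i := if h : i.1.1 + (i.1.2 : CyclicVertex N) = p.1 ∧
    ¬ D.HasRel i.1.1 (i.1.2 + p.2.2.length) then φ ⟨(i.1.1, i.1.2 + p.2.2.length), h.2⟩ else 0
  map_add' φ ψ := by
    ext i
    simp only [Pi.add_apply]
    split_ifs <;> simp
  map_smul' c φ := by
    ext i
    simp only [Pi.smul_apply, RingHom.id_apply]
    split_ifs <;> simp

open Classical in
theorem pathAction_apply (p : AllPaths (CyclicVertex N))
    (φ : {i : CyclicVertex N × ℕ // ¬ D.HasRel i.1 i.2} → k) (i) :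
    D.pathAction k p φ i = if h : i.1.1 + (i.1.2 : CyclicVertex N) = p.1 ∧
      ¬ D.HasRel i.1.1 (i.1.2 + p.2.2.length)
        then φ ⟨(i.1.1, i.1.2 + p.2.2.length), h.2⟩ else 0 := rfl

variable [NeZero N]

theorem exists_hasRel : ∃ n, ∀ x, D.HasRel x n := by
  obtain ⟨ρ, hρ⟩ := D.nonempty
  -- From any vertex the start of `ρ` is reached in fewer than `N` steps.
  refine ⟨N + ρ.2, fun x => ⟨ρ, hρ, ZMod.val (n := N) (ρ.1 - x), ?_, ?_⟩⟩
  · have h : ((ZMod.val (n := N) (ρ.1 - x) : ℕ) : CyclicVertex N) = ρ.1 - x :=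
      ZMod.natCast_zmod_val (n := N) _
    rw [h]
    ring
  · have := ZMod.val_lt (n := N) (ρ.1 - x)
    omega

theorem walk_mul_walk (x : CyclicVertex N) (d e : ℕ) :
    D.walk k x d * D.walk k (x + (d : CyclicVertex N)) e = D.walk k x (d + e) := by
  rw [← cyclicWalk_fst]
  refine (BoundQuiverAlgebra.path_mul_path k D.paths _ _).trans ?_
  refine congrArg (BoundQuiverAlgebra.path k D.paths)
    ((CyclicVertex.path_eq _).trans ?_)
  simp [length_cyclicWalk]

theorem walk_mul_walk_of_ne (x y : CyclicVertex N) (d e : ℕ) (h : y ≠ x + (d : CyclicVertex N)) :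
    D.walk k x d * D.walk k y e = 0 :=
  BoundQuiverAlgebra.path_mul_path_of_ne k D.paths _ _ fun h' =>
    h (h'.symm.trans (cyclicWalk_fst x d))

theorem walk_eq_zero {x : CyclicVertex N} {d : ℕ} (h : D.HasRel x d) : D.walk k x d = 0 := by
  obtain ⟨ρ, hρ, t, ht, hle⟩ := h
  obtain ⟨s, rfl⟩ := Nat.exists_eq_add_of_le hle
  have h0 : D.walk k ρ.1 ρ.2 = 0 := BoundQuiverAlgebra.path_eq_zero k ⟨ρ, hρ, rfl⟩
  rw [← D.walk_mul_walk, ← D.walk_mul_walk, ← ht, h0, mul_zero, zero_mul]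

/-- The representation of a cyclic Nakayama algebra on the functions on the set of all paths that
contain no relation. -/
def pathRep : D.Alg k →ₐ[k]
    Module.End k ({i : CyclicVertex N × ℕ // ¬ D.HasRel i.1 i.2} → k) :=
  BoundQuiverAlgebra.lift k D.paths (PathAlgebra.lift k (D.pathAction k)
    (fun x y z p q => by
      refine LinearMap.ext fun φ => funext fun i => ?_
      obtain ⟨⟨a, t⟩, hi⟩ := i
      rw [Module.End.mul_apply]
      simp only [pathAction_apply, Quiver.Path.length_comp]
      have hy := CyclicVertex.target_eq p
      by_cases h1 : a + (t : CyclicVertex N) = x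
      · by_cases h2 : D.HasRel a (t + (p.length + q.length))
        · have h2' : D.HasRel a (t + p.length + q.length) := by rwa [add_assoc]
          simp [h2, h2']
        · have h2' : ¬ D.HasRel a (t + p.length + q.length) := by rwa [add_assoc]
          have h3 : ¬ D.HasRel a (t + p.length) := fun h => h2' (h.mono (by omega))
          have h4 : a + ((t : CyclicVertex N) + (p.length : CyclicVertex N)) = y := by
            exact (add_assoc _ _ _).symm.trans
              ((congrArg (· + (p.length : CyclicVertex N)) h1).trans
                hy.symm)
          simp [h1, h2, h3, h4, add_assoc]
      · simp [h1])
    (fun p q h => by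
      refine LinearMap.ext fun φ => funext fun i => ?_
      rw [Module.End.mul_apply]
      simp only [pathAction_apply]
      split_ifs with h1 h2
      · refine absurd ?_ h
        refine (CyclicVertex.target_eq p.2.2).trans (Eq.trans ?_ h2.1)
        rw [Nat.cast_add, ← add_assoc, h1.1]
      · rfl
      · rfl)
    (by
      refine LinearMap.ext fun φ => funext fun i => ?_
      rw [LinearMap.sum_apply, Finset.sum_apply,
        Finset.sum_eq_single (i.1.1 + (i.1.2 : CyclicVertex N))]
      · rw [pathAction_apply, dif_pos ⟨rfl, i.2⟩]
        rfl
      · intro y _ hy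
        rw [pathAction_apply, dif_neg fun h => hy h.1.symm]
      · simp))
    (by
      rintro _ ⟨ρ, hρ, rfl⟩
      rw [PathAlgebra.lift_ofPath]
      refine LinearMap.ext fun φ => funext fun i => ?_
      rw [pathAction_apply, dif_neg]
      · rfl
      · rintro ⟨h1, h2⟩
        refine h2 ⟨ρ, hρ, i.1.2, h1.symm, ?_⟩
        rw [length_cyclicWalk])

/-- A path free of relations is detected by `pathRep`: it sends the constant function `1` to a
function with value `1` at the trivial path at `x`. -/
theorem walk_eq_zero_iff {x : CyclicVertex N} {d : ℕ} : D.walk k x d = 0 ↔ D.HasRel x d := by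
  refine ⟨fun h => ?_, D.walk_eq_zero k⟩
  by_contra hd
  have hx : ¬ D.HasRel x 0 := fun h => hd (h.mono (Nat.zero_le d))
  have h1 := congrArg (fun T : Module.End k _ => T (fun _ => 1) ⟨(x, 0), hx⟩)
    (congrArg (D.pathRep k) h)
  rw [map_zero] at h1
  simp only [walk, pathRep, BoundQuiverAlgebra.lift_path, PathAlgebra.lift_ofPath] at h1
  rw [pathAction_apply, dif_pos ⟨by simp, by simpa [length_cyclicWalk] using hd⟩] at h1
  exact one_ne_zero h1

/-- The serial system formed by the residue classes of the paths. -/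
def system : SerialSystem k (D.Alg k)ᵐᵒᵖ (CyclicVertex N) where
  next := Equiv.addRight 1
  w x d := MulOpposite.op (D.walk k x d)
  w_zero_ne x := by
    rw [Ne, MulOpposite.op_eq_zero_iff, walk_eq_zero_iff]
    exact D.not_hasRel_zero x
  w_mul x d e := by
    rw [iterate_add_one, ← MulOpposite.op_mul, walk_mul_walk]
  w_mul_of_ne x y d e h := by
    rw [iterate_add_one] at h
    rw [← MulOpposite.op_mul, walk_mul_walk_of_ne _ _ _ _ _ _ h, MulOpposite.op_zero]
  sum_w := by
    rw [← MulOpposite.op_one, ← BoundQuiverAlgebra.sum_path_nil k D.paths]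
    exact (map_sum (MulOpposite.opAddEquiv : D.Alg k ≃+ (D.Alg k)ᵐᵒᵖ) _ _).symm
  exists_w_eq_zero := D.exists_hasRel.imp fun _ h x => by
    rw [D.walk_eq_zero k (h x), MulOpposite.op_zero]
  span_w := by
    have h := congrArg (Submodule.map (MulOpposite.opLinearEquiv k).toLinearMap)
      (BoundQuiverAlgebra.span_path k D.paths)
    rw [Submodule.map_span, ← Set.range_comp, Submodule.map_top, LinearEquiv.range] at h
    rw [eq_top_iff, ← h]
    refine Submodule.span_mono ?_
    rintro _ ⟨p, rfl⟩
    exact ⟨(p.1, p.2.2.length), congrArg MulOpposite.op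
      (congrArg (BoundQuiverAlgebra.path k D.paths) (CyclicVertex.path_eq p).symm)⟩

theorem iterate_system_next (x : CyclicVertex N) (d : ℕ) :
    (D.system k).next^[d] x = x + (d : CyclicVertex N) := iterate_add_one x d

theorem system_c_le_iff {x : CyclicVertex N} {d : ℕ} : (D.system k).c x ≤ d ↔ D.HasRel x d := by
  rw [← SerialSystem.w_eq_zero_iff, ← D.walk_eq_zero_iff k]
  exact MulOpposite.op_eq_zero_iff _

/-- By minimality the shortest vanishing path from `x` stops exactly where the relation inside it
stops, and the targets of relations form `𝒮'(Λ)`. -/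
theorem add_c_mem_syzVertices (x : CyclicVertex N) :
    x + ((D.system k).c x : CyclicVertex N) ∈ D.syzVertices := by
  obtain ⟨ρ, hρ, t, ht, hle⟩ := (D.system_c_le_iff k (x := x)).1 le_rfl
  have hge := (D.system_c_le_iff k).2 ⟨ρ, hρ, t, ht, le_rfl⟩
  rw [← le_antisymm hle hge]
  refine Finset.mem_image.2 ⟨_, Finset.mem_image_of_mem _ hρ, ?_⟩
  rw [ht]
  push_cast
  ring

end CyclicRelations

/-! ### The serial system of the syzygy filtered algebra -/

namespace CyclicRelations

variable {N : ℕ} {D : CyclicRelations N} {k : Type u}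

theorem EpsVertex.val_injective :
    Function.Injective (EpsVertex.val : D.EpsVertex k → CyclicVertex N) :=
  Subtype.val_injective

theorem gap_le {x : CyclicVertex N} {d : ℕ} (hd : 1 ≤ d)
    (h : x + (d : CyclicVertex N) ∈ D.syzVertices) : D.gap x ≤ d :=
  Nat.sInf_le ⟨hd, h⟩

variable [NeZero N]

/-! ### Combinatorics of the cyclic order on `𝒮'(Λ)` -/

namespace EpsVertex

theorem val_next (x : D.EpsVertex k) :
    x.next.val = x.val + (D.gap x.val : CyclicVertex N) := rfl

/-- If two elements had the same successor, the one with the smaller gap would lie strictly between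
the other and that successor. -/
theorem next_injective : Function.Injective (next : D.EpsVertex k → D.EpsVertex k) := by
  have key : ∀ x y : D.EpsVertex k, x.next = y.next → D.gap x.val ≤ D.gap y.val → x = y := by
    intro x y h hle
    have h' : x.val + (D.gap x.val : CyclicVertex N) = y.val + (D.gap y.val : CyclicVertex N) :=
      congrArg EpsVertex.val h
    have hx : y.val + ((D.gap y.val - D.gap x.val : ℕ) : CyclicVertex N) = x.val := by
      rw [Nat.cast_sub hle, ← add_sub_assoc, ← h', add_sub_cancel_right]
    by_cases h0 : D.gap y.val - D.gap x.val = 0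
    · refine val_injective ?_
      rw [← hx, h0, Nat.cast_zero, add_zero]
    · have h1 := gap_le (D := D) (x := y.val) (d := D.gap y.val - D.gap x.val) (by omega)
        (by rw [hx]; exact x.2)
      have h2 := (D.gap_mem x.val).1
      omega
  intro x y h
  rcases le_total (D.gap x.val) (D.gap y.val) with hle | hle
  · exact key x y h hle
  · exact (key y x h.symm hle).symm

/-- The cyclic successor as a permutation. -/
def nextEquiv : Equiv.Perm (D.EpsVertex k) :=
  Equiv.ofBijective next (Finite.injective_iff_bijective.1 next_injective)

theorem coe_nextEquiv : (nextEquiv : D.EpsVertex k → D.EpsVertex k) = next := rfl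

/-- The number of steps from `x` to its `j`-th successor. -/
def dist (x : D.EpsVertex k) : ℕ → ℕ
  | 0 => 0
  | j + 1 => x.dist j + D.gap (next^[j] x).val

theorem val_iterate (x : D.EpsVertex k) (j : ℕ) :
    (next^[j] x).val = x.val + (x.dist j : CyclicVertex N) := by
  induction j with
  | zero => simp [dist]
  | succ j ih => rw [Function.iterate_succ_apply', val_next, ih, dist, ← ih, Nat.cast_add,
      ← add_assoc, ← ih]

theorem dist_add (x : D.EpsVertex k) (i j : ℕ) :
    x.dist (i + j) = x.dist i + (next^[i] x).dist j := by
  induction j with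
  | zero => rfl
  | succ j ih =>
    rw [← add_assoc, dist, ih, dist, ← Function.iterate_add_apply, add_comm j i, add_assoc]

theorem dist_strictMono (x : D.EpsVertex k) : StrictMono x.dist :=
  strictMono_nat_of_lt_succ fun j => by
    have := (D.gap_mem (next^[j] x).val).1
    rw [dist]
    omega

/-- A path between elements of `𝒮'(Λ)` is trivial or covers the first gap; remove this gap and
induct. -/
theorem exists_dist_eq (x : D.EpsVertex k) (d : ℕ)
    (h : x.val + (d : CyclicVertex N) ∈ D.syzVertices) : ∃ j, d = x.dist j := by
  induction d using Nat.strong_induction_on generalizing x with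
  | _ d ih =>
  rcases Nat.eq_zero_or_pos d with rfl | hd
  · exact ⟨0, rfl⟩
  have hle := gap_le hd h
  have hpos := (D.gap_mem x.val).1
  obtain ⟨j, hj⟩ := ih (d - D.gap x.val) (by omega) x.next (by
    rw [val_next, Nat.cast_sub hle, add_add_sub_cancel]
    exact h)
  refine ⟨1 + j, ?_⟩
  rw [dist_add, Function.iterate_one, ← hj, dist, dist]
  simp only [Function.iterate_zero, id_eq]
  omega

theorem exists_iterate_eq (x y : D.EpsVertex k) : ∃ j, next^[j] x = y := by
  have h : ((ZMod.val (n := N) (y.val - x.val) : ℕ) : CyclicVertex N) = y.val - x.val :=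
    ZMod.natCast_zmod_val (n := N) _
  obtain ⟨j, hj⟩ := x.exists_dist_eq (ZMod.val (n := N) (y.val - x.val)) (by
    rw [h, add_sub_cancel]
    exact y.2)
  refine ⟨j, val_injective ?_⟩
  rw [val_iterate, ← hj, h, add_sub_cancel]

end EpsVertex

/-! ### Homomorphisms between the projectives `P_x` and endomorphisms of their sum -/

variable (D k) [Field k]

theorem walk_zero_mul_walk (x : CyclicVertex N) (d : ℕ) :
    D.walk k x 0 * D.walk k x d = D.walk k x d := by
  simpa using D.walk_mul_walk k x 0 d

theorem isAt_walk_zero (x : CyclicVertex N) :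
    (D.system k).IsAt x ((D.system k).c x) (D.walk k x 0) where
  w_zero_smul := D.walk_zero_mul_walk k x 0
  w_smul_eq_zero_iff d := by
    rw [← SerialSystem.w_eq_zero_iff]
    change D.walk k x 0 * D.walk k x d = 0 ↔ MulOpposite.op (D.walk k x d) = 0
    rw [walk_zero_mul_walk, MulOpposite.op_eq_zero_iff]

theorem walk_mem_proj (x : CyclicVertex N) (d : ℕ) (a : D.Alg k) :
    D.walk k x d * a ∈ D.Proj k x := by
  rw [← walk_zero_mul_walk, mul_assoc]
  exact Submodule.smul_mem _ (MulOpposite.op (D.walk k x d * a))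
    (Submodule.mem_span_singleton_self (D.walk k x 0))

theorem walk_zero_mul_coe (x : CyclicVertex N) (m : D.Proj k x) :
    D.walk k x 0 * (m : D.Alg k) = m := by
  obtain ⟨r, hr⟩ := Submodule.mem_span_singleton.1 m.2
  have hr' : D.walk k x 0 * r.unop = m := hr
  rw [← hr', ← mul_assoc, walk_zero_mul_walk]

/-- The generator of `P_x`. -/
def top (x : CyclicVertex N) : D.Proj k x := ⟨D.walk k x 0, Submodule.mem_span_singleton_self _⟩

/-- Left multiplication by a path, as a homomorphism between projective modules. -/
def leftWalk (x y : CyclicVertex N) (d : ℕ) : D.Proj k y →ₗ[(D.Alg k)ᵐᵒᵖ] D.Proj k x where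
  toFun m := ⟨D.walk k x d * m, D.walk_mem_proj k x d m⟩
  map_add' _ _ := Subtype.ext (mul_add _ _ _)
  map_smul' r m := Subtype.ext (mul_assoc (D.walk k x d) (m : D.Alg k) r.unop).symm

theorem coe_leftWalk (x y : CyclicVertex N) (d : ℕ) (m : D.Proj k y) :
    (D.leftWalk k x y d m : D.Alg k) = D.walk k x d * m := rfl

theorem proj_hom_ext {x : CyclicVertex N} {M : Type*} [AddCommGroup M] [Module (D.Alg k)ᵐᵒᵖ M]
    {f g : D.Proj k x →ₗ[(D.Alg k)ᵐᵒᵖ] M} (h : f (D.top k x) = g (D.top k x)) : f = g := by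
  ext m
  obtain ⟨r, hr⟩ := Submodule.mem_span_singleton.1 m.2
  have hm : m = r • D.top k x := Subtype.ext hr.symm
  rw [hm, map_smul, map_smul, h]

/-- The map is determined by the image of the top generator. Expand this image in paths from `x`;
right multiplication by the idempotent at `y` discards the paths not ending at `y`. -/
theorem hom_mem_span (x y : CyclicVertex N) (f : D.Proj k y →ₗ[(D.Alg k)ᵐᵒᵖ] D.Proj k x) :
    f ∈ Submodule.span k {g | ∃ d : ℕ, y = x + (d : CyclicVertex N) ∧ g = D.leftWalk k x y d} := by
  obtain ⟨a, ha⟩ := (D.system k).exists_expansion x (MulOpposite.op (f (D.top k y) : D.Alg k))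
  have ha' : (f (D.top k y) : D.Alg k) =
      ∑ d ∈ Finset.range ((D.system k).c x), a d • D.walk k x d := by
    refine (D.walk_zero_mul_coe k x _).symm.trans (MulOpposite.op_injective ?_)
    refine ha.trans ?_
    rw [Finset.op_sum]
    refine Finset.sum_congr rfl fun d _ => ?_
    rw [← Algebra.smul_def]
    rfl
  have hy : (f (D.top k y) : D.Alg k) * D.walk k y 0 = f (D.top k y) := by
    have h : D.top k y = MulOpposite.op (D.walk k y 0) • D.top k y :=
      Subtype.ext (D.walk_zero_mul_walk k y 0).symm
    conv_rhs => rw [h, map_smul]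
    rfl
  have hf : f = ∑ d ∈ Finset.range ((D.system k).c x) with y = x + (d : ℕ),
      a d • D.leftWalk k x y d := by
    refine D.proj_hom_ext k (Subtype.ext ?_)
    rw [← hy, ha', Finset.sum_mul, LinearMap.sum_apply, AddSubmonoidClass.coe_finsetSum,
      Finset.sum_filter]
    refine Finset.sum_congr rfl fun d _ => ?_
    split_ifs with h
    · rw [smul_mul_assoc]
      rfl
    · rw [smul_mul_assoc, D.walk_mul_walk_of_ne k _ _ _ _ h, smul_zero]
  rw [hf]
  exact Submodule.sum_mem _ fun d hd => Submodule.smul_mem _ _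
    (Submodule.subset_span ⟨d, (Finset.mem_filter.1 hd).2, rfl⟩)

/-- The inclusion of a summand of `⊕ P_i`. -/
def incl (x : D.EpsVertex k) : D.Proj k x.val →ₗ[(D.Alg k)ᵐᵒᵖ] D.SyzProj k :=
  LinearMap.single (D.Alg k)ᵐᵒᵖ (fun i : {i // i ∈ D.syzVertices} => D.Proj k i) x

/-- The projection onto a summand of `⊕ P_i`. -/
def coord (x : D.EpsVertex k) : D.SyzProj k →ₗ[(D.Alg k)ᵐᵒᵖ] D.Proj k x.val :=
  LinearMap.proj (R := (D.Alg k)ᵐᵒᵖ) (φ := fun i : {i // i ∈ D.syzVertices} => D.Proj k i) x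

theorem coord_comp_incl (x : D.EpsVertex k) : D.coord k x ∘ₗ D.incl k x = LinearMap.id :=
  LinearMap.proj_comp_single_same _ _ _

theorem coord_comp_incl_of_ne {x y : D.EpsVertex k} (h : y ≠ x) :
    D.coord k y ∘ₗ D.incl k x = 0 :=
  LinearMap.proj_comp_single_ne _ _ _ _ h

theorem sum_incl_comp_coord : ∑ x : D.EpsVertex k, D.incl k x ∘ₗ D.coord k x = LinearMap.id := by
  refine LinearMap.ext fun m => ?_
  rw [LinearMap.sum_apply]
  exact Finset.univ_sum_single (M := fun i : {i // i ∈ D.syzVertices} => D.Proj k i) m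

/-- The endomorphism of `⊕ P_i` given by left multiplication with a path. -/
def endWalk (x y : D.EpsVertex k) (d : ℕ) : D.Eps k :=
  D.incl k x ∘ₗ D.leftWalk k x.val y.val d ∘ₗ D.coord k y

theorem coord_comp_endWalk (x y : D.EpsVertex k) (d : ℕ) :
    D.coord k x ∘ₗ D.endWalk k x y d = D.leftWalk k x.val y.val d ∘ₗ D.coord k y := by
  rw [endWalk, ← LinearMap.comp_assoc, coord_comp_incl, LinearMap.id_comp]

theorem endWalk_mul_endWalk (x y z : D.EpsVertex k) (d e : ℕ)
    (h : y.val = x.val + (d : CyclicVertex N)) :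
    D.endWalk k x y d * D.endWalk k y z e = D.endWalk k x z (d + e) := by
  have hw : D.leftWalk k x.val y.val d ∘ₗ D.leftWalk k y.val z.val e =
      D.leftWalk k x.val z.val (d + e) := by
    ext m
    simp only [LinearMap.comp_apply, coe_leftWalk]
    rw [← mul_assoc, h, walk_mul_walk]
  change (D.incl k x ∘ₗ D.leftWalk k x.val y.val d ∘ₗ D.coord k y) ∘ₗ D.endWalk k y z e = _
  rw [LinearMap.comp_assoc, LinearMap.comp_assoc, coord_comp_endWalk,
    ← LinearMap.comp_assoc _ _ (D.leftWalk k x.val y.val d),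
    hw]
  rfl

theorem endWalk_mul_endWalk_of_ne (x y y' z : D.EpsVertex k) (d e : ℕ) (h : y ≠ y') :
    D.endWalk k x y d * D.endWalk k y' z e = 0 := by
  change (D.incl k x ∘ₗ D.leftWalk k x.val y.val d ∘ₗ D.coord k y) ∘ₗ
    (D.incl k y' ∘ₗ D.leftWalk k y'.val z.val e ∘ₗ D.coord k z) = 0
  rw [LinearMap.comp_assoc, LinearMap.comp_assoc, ← LinearMap.comp_assoc _ _ (D.coord k y),
    coord_comp_incl_of_ne _ _ h, LinearMap.zero_comp, LinearMap.comp_zero, LinearMap.comp_zero]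

theorem endWalk_eq_zero_iff {x y : D.EpsVertex k} {d : ℕ}
    (h : y.val = x.val + (d : CyclicVertex N)) :
    D.endWalk k x y d = 0 ↔ D.HasRel x.val d := by
  rw [← D.walk_eq_zero_iff k]
  constructor
  · intro h0
    have h1 := congrArg (fun T : D.Eps k =>
      (D.coord k x (T (D.incl k y (D.top k y.val))) : D.Alg k)) h0
    have h2 : D.coord k x (D.endWalk k x y d (D.incl k y (D.top k y.val))) =
        D.leftWalk k x.val y.val d (D.top k y.val) := by
      have := LinearMap.congr_fun (D.coord_comp_endWalk k x y d) (D.incl k y (D.top k y.val))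
      refine this.trans ?_
      rw [LinearMap.comp_apply]
      congr 1
      exact LinearMap.congr_fun (D.coord_comp_incl k y) _
    simp only [h2, LinearMap.zero_apply, map_zero] at h1
    rw [coe_leftWalk] at h1
    change D.walk k x.val d * D.walk k y.val 0 = 0 at h1
    rwa [h, walk_mul_walk] at h1
  · intro h0
    have h1 : D.leftWalk k x.val y.val d = 0 := by
      ext m
      rw [coe_leftWalk, h0, zero_mul]
      rfl
    rw [endWalk, h1, LinearMap.zero_comp, LinearMap.comp_zero]

theorem endWalk_zero (x : D.EpsVertex k) : D.endWalk k x x 0 = D.incl k x ∘ₗ D.coord k x := by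
  have h : D.leftWalk k x.val x.val 0 = LinearMap.id := by
    ext m
    exact D.walk_zero_mul_coe k x.val m
  rw [endWalk, h, LinearMap.id_comp]

theorem eq_sum_comp (T : D.Eps k) : T = ∑ x : D.EpsVertex k, ∑ y : D.EpsVertex k,
    D.incl k x ∘ₗ (D.coord k x ∘ₗ T ∘ₗ D.incl k y) ∘ₗ D.coord k y := by
  refine LinearMap.ext fun m => ?_
  have h (m : D.SyzProj k) : ∑ x : D.EpsVertex k, D.incl k x (D.coord k x m) = m := by
    simpa [LinearMap.sum_apply] using LinearMap.congr_fun (D.sum_incl_comp_coord k) m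
  simp only [LinearMap.sum_apply, LinearMap.comp_apply]
  simp only [← map_sum, h]

theorem op_comp_mem_span (x y : D.EpsVertex k)
    (f : D.Proj k y.val →ₗ[(D.Alg k)ᵐᵒᵖ] D.Proj k x.val) :
    MulOpposite.op (D.incl k x ∘ₗ f ∘ₗ D.coord k y : D.Eps k) ∈ Submodule.span k
      {T | ∃ j : ℕ, EpsVertex.next^[j] x = y ∧
        T = MulOpposite.op (D.endWalk k x y (x.dist j))} := by
  induction D.hom_mem_span k x.val y.val f using Submodule.span_induction with
  | mem f hf =>
    obtain ⟨d, hd, rfl⟩ := hf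
    obtain ⟨j, rfl⟩ := x.exists_dist_eq d (hd ▸ y.2)
    exact Submodule.subset_span ⟨j, EpsVertex.val_injective ((x.val_iterate j).trans hd.symm), rfl⟩
  | zero =>
    rw [LinearMap.zero_comp, LinearMap.comp_zero]
    exact zero_mem _
  | add f g _ _ hf hg =>
    rw [LinearMap.add_comp, LinearMap.comp_add]
    exact add_mem hf hg
  | smul c f _ hf =>
    have h : D.incl k x ∘ₗ (c • f) ∘ₗ D.coord k y =
        c • (D.incl k x ∘ₗ f ∘ₗ D.coord k y : D.Eps k) :=
      LinearMap.ext fun m => LinearMap.map_smul_of_tower (D.incl k x) c _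
    rw [h]
    exact Submodule.smul_mem _ c hf

/-- The serial system of `ε(Λ)`. -/
def epsSystem : SerialSystem k (D.Eps k)ᵐᵒᵖ (D.EpsVertex k) where
  next := EpsVertex.nextEquiv
  w x j := MulOpposite.op (D.endWalk k x (EpsVertex.next^[j] x) (x.dist j))
  w_zero_ne x := by
    rw [Ne, MulOpposite.op_eq_zero_iff, endWalk_eq_zero_iff _ _ (x.val_iterate 0)]
    exact D.not_hasRel_zero x.val
  w_mul x i j := by
    rw [← MulOpposite.op_mul, EpsVertex.coe_nextEquiv,
      endWalk_mul_endWalk _ _ _ _ _ _ _ (x.val_iterate i), ← Function.iterate_add_apply,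
      ← EpsVertex.dist_add, add_comm j i]
  w_mul_of_ne x y i j h := by
    rw [← MulOpposite.op_mul, endWalk_mul_endWalk_of_ne _ _ _ _ _ _ _ _ (by exact Ne.symm h),
      MulOpposite.op_zero]
  sum_w := by
    have h : (1 : D.Eps k) = ∑ x : D.EpsVertex k, D.endWalk k x x 0 := by
      simp only [endWalk_zero]
      exact (D.sum_incl_comp_coord k).symm
    rw [← MulOpposite.op_one, h]
    exact (map_sum (MulOpposite.opAddEquiv : D.Eps k ≃+ (D.Eps k)ᵐᵒᵖ) _ _).symm
  -- The bound for `Λ` serves again, since `n` jumps cover at least `n` steps.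
  exists_w_eq_zero := D.exists_hasRel.imp fun n h x => by
    rw [MulOpposite.op_eq_zero_iff, endWalk_eq_zero_iff _ _ (x.val_iterate n)]
    exact (h x.val).mono (x.dist_strictMono.le_apply)
  span_w := by
    rw [eq_top_iff]
    intro T _
    rw [← MulOpposite.op_unop T, D.eq_sum_comp k T.unop, Finset.op_sum]
    refine Submodule.sum_mem _ fun x _ => ?_
    rw [Finset.op_sum]
    refine Submodule.sum_mem _ fun y _ => ?_
    refine Submodule.span_mono ?_ (D.op_comp_mem_span k x y _)
    rintro _ ⟨j, rfl, rfl⟩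
    exact ⟨(x, j), rfl⟩

theorem epsSystem_c_le_iff {x : D.EpsVertex k} {j : ℕ} :
    (D.epsSystem k).c x ≤ j ↔ (D.system k).c x.val ≤ x.dist j := by
  rw [← SerialSystem.w_eq_zero_iff, system_c_le_iff,
    ← endWalk_eq_zero_iff D k (x.val_iterate j)]
  exact MulOpposite.op_eq_zero_iff _

end CyclicRelations

/-! ### Connected serial systems without sinks -/

namespace SerialSystem

variable {k : Type u} [Field k] {A : Type u} [Ring A] [Algebra k A]

section Cyclic

variable {n : ℕ} [NeZero n] (S : SerialSystem k Aᵐᵒᵖ (CyclicVertex n))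

/-- The minimal relations of a serial system on the cyclic quiver. -/
def cyclicRelations (hnext : ∀ i, S.next i = i + 1) (h2 : ∀ i, 2 ≤ S.c i) :
    CyclicRelations n where
  rel := (Finset.univ.filter fun i => S.c i ≤ S.c (S.next i)).image fun i => (i, S.c i)
  nonempty := by
    -- A vertex where `c` is minimal satisfies `c i ≤ c (next i)`.
    obtain ⟨i, -, hi⟩ := Finset.exists_min_image Finset.univ S.c ⟨0, Finset.mem_univ _⟩
    exact ⟨_, Finset.mem_image_of_mem _
      (Finset.mem_filter.2 ⟨Finset.mem_univ i, hi _ (Finset.mem_univ _)⟩)⟩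
  two_le := by
    intro ρ hρ
    obtain ⟨i, -, rfl⟩ := Finset.mem_image.1 hρ
    exact h2 i
  irredundant := by
    intro ρ hρ σ hσ
    obtain ⟨i, -, rfl⟩ := Finset.mem_image.1 hρ
    obtain ⟨j, hj, rfl⟩ := Finset.mem_image.1 hσ
    rintro ⟨t, ht, hle⟩
    rcases t with _ | t
    · have : i = j := by simpa using ht
      rw [this]
    · exfalso
      have h1 := (Finset.mem_filter.1 hj).2
      -- A relation at `i = j + t + 1` inside the one at `j` gives `t + 1 + c i ≤ c j ≤ c (next j) ≤
      -- t + c i`, which is absurd.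
      have h3 := S.c_le_add (S.next j) t
      have hi : S.next^[t] (S.next j) = i := by
        rw [← Function.iterate_succ_apply, show (S.next : _ → _) = fun i => i + 1 from funext hnext]
        refine Eq.trans ?_ ht.symm
        exact iterate_add_one j (t + 1)
      rw [hi] at h3
      simp only at hle
      omega

theorem isCyclicNakayama_of_cyclicVertex (hnext : ∀ i, S.next i = i + 1) (h2 : ∀ i, 2 ≤ S.c i) :
    IsCyclicNakayama k A n := by
  refine ⟨inferInstance, S.cyclicRelations hnext h2, ?_⟩
  refine nonempty_algEquiv (S := S) _ CyclicVertex.subsingleton_hom (fun x y => ?_) fun p => ?_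
  · rw [hnext]
    exact ⟨fun ⟨(e : PLift _)⟩ => ⟨h2 x, e.down⟩, fun h => ⟨(⟨h.2⟩ : PLift _)⟩⟩
  · constructor
    · rintro ⟨ρ, hρ, rfl⟩
      obtain ⟨i, hi, rfl⟩ := Finset.mem_image.1 hρ
      exact ⟨length_cyclicWalk _ _, h2 _, (Finset.mem_filter.1 hi).2⟩
    · rintro ⟨hp, -, hle⟩
      refine ⟨(p.1, S.c p.1), Finset.mem_image_of_mem _
        (Finset.mem_filter.2 ⟨Finset.mem_univ _, hle⟩), ?_⟩
      rw [← hp]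
      exact CyclicVertex.path_eq p

end Cyclic

variable {V : Type w} [Fintype V]

/-- As `next` has a single orbit, counting steps from `x` identifies the vertices with `ℤ/n` and
`next` with adding one. -/
theorem isCyclicNakayama (S : SerialSystem k Aᵐᵒᵖ V) {x : V}
    (hx : ∀ y, ∃ d, S.next^[d] x = y) (h2 : ∀ y, 2 ≤ S.c y) :
    IsCyclicNakayama k A (Fintype.card V) := by
  classical
  have hcard : NeZero (Fintype.card V) := ⟨(Fintype.card_pos_iff.2 ⟨x⟩).ne'⟩
  have hcyc : S.next.IsCycleOn (Finset.univ : Finset V) := by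
    refine ⟨by simp, fun y _ z _ => ?_⟩
    obtain ⟨d, rfl⟩ := hx y
    obtain ⟨e, rfl⟩ := hx z
    refine ⟨(e : ℤ) - d, ?_⟩
    rw [Equiv.Perm.iterate_eq_pow, Equiv.Perm.iterate_eq_pow, ← Equiv.Perm.mul_apply,
      ← zpow_natCast, ← zpow_natCast, ← zpow_add, sub_add_cancel]
  have hmod (a b : ℕ) : (S.next ^ a) x = (S.next ^ b) x ↔ a ≡ b [MOD Fintype.card V] :=
    hcyc.pow_apply_eq_pow_apply (Finset.mem_univ x)
  let f : CyclicVertex (Fintype.card V) → V := fun i =>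
    (S.next ^ ZMod.val (n := Fintype.card V) i) x
  have hf : Function.Bijective f := by
    rw [Fintype.bijective_iff_injective_and_card]
    refine ⟨fun i j hij => ?_, ZMod.card (Fintype.card V)⟩
    refine ZMod.val_injective (Fintype.card V) ?_
    exact ((hmod _ _).1 hij).eq_of_lt_of_lt (ZMod.val_lt (n := Fintype.card V) i)
      (ZMod.val_lt (n := Fintype.card V) j)
  have hfnext (i) : S.next (f i) = f (i + 1) := by
    change S.next ((S.next ^ _) x) = (S.next ^ _) x
    rw [← Equiv.Perm.mul_apply, ← pow_succ', hmod]
    have h (j : ZMod (Fintype.card V)) : j.val + 1 ≡ (j + 1).val [MOD Fintype.card V] := by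
      rw [← ZMod.natCast_eq_natCast_iff, ZMod.natCast_zmod_val, Nat.cast_add,
        ZMod.natCast_zmod_val, Nat.cast_one]
    exact h i
  refine (S.reindex (Equiv.ofBijective f hf).symm).isCyclicNakayama_of_cyclicVertex
    (fun i => ?_) fun i => ?_
  · change (Equiv.ofBijective f hf).symm (S.next (f i)) = i + 1
    rw [hfnext]
    exact (Equiv.ofBijective f hf).symm_apply_apply _
  · rw [c_reindex]
    exact h2 _

end SerialSystem

/-! ### Modules over the syzygy filtered algebra -/

namespace CyclicRelations

variable {N : ℕ} [NeZero N] (D : CyclicRelations N) (k : Type u) [Field k]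

theorem projective_syzProj : Module.Projective (D.Alg k)ᵐᵒᵖ (D.SyzProj k) := by
  classical
  have h (i : {i // i ∈ D.syzVertices}) : Module.Projective (D.Alg k)ᵐᵒᵖ (D.Proj k i) :=
    (D.isAt_walk_zero k i).isInterval_span.projective
  exact Module.Projective.of_equiv
    (DFinsupp.linearEquivFunOnFintype (R := (D.Alg k)ᵐᵒᵖ)
      (M := fun i : {i // i ∈ D.syzVertices} => D.Proj k i))

variable {D k}

/-- A homomorphism from `⊕ P_i` to `X` as an element of `H(X)`. -/
def toH {X : Type u} [AddCommGroup X] [Module (D.Alg k)ᵐᵒᵖ X]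
    (f : D.SyzProj k →ₗ[(D.Alg k)ᵐᵒᵖ] X) : D.H k X := f

section

variable {X : Type u} [AddCommGroup X] [Module (D.Alg k)ᵐᵒᵖ X]

theorem w_smul_toH (x : D.EpsVertex k) (j : ℕ) (f : D.SyzProj k →ₗ[(D.Alg k)ᵐᵒᵖ] X) :
    (D.epsSystem k).w x j • toH f =
      toH (f ∘ₗ D.endWalk k x (EpsVertex.next^[j] x) (x.dist j)) := rfl

theorem toH_eq_zero_iff (f : D.SyzProj k →ₗ[(D.Alg k)ᵐᵒᵖ] X) : toH f = 0 ↔ f = 0 := Iff.rfl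

theorem span_toH_eq_top (u : D.SyzProj k →ₗ[(D.Alg k)ᵐᵒᵖ] X)
    (h : ∀ f : D.SyzProj k →ₗ[(D.Alg k)ᵐᵒᵖ] X, ∃ T : D.Eps k, u ∘ₗ T = f) :
    Submodule.span (D.Eps k)ᵐᵒᵖ {toH u} = ⊤ := by
  rw [eq_top_iff]
  intro f _
  obtain ⟨T, hT⟩ := h f
  have hT' : MulOpposite.op T • toH u = f := hT
  rw [← hT']
  exact Submodule.smul_mem _ _ (Submodule.mem_span_singleton_self _)

end

/-- The generator is the projection onto `P_x`: every map into `P_x` factors through it by way of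
the inclusion, and no path is lost since `endWalk` from `x` takes values in the summand `P_x`. -/
theorem isInterval_proj (x : D.EpsVertex k) :
    (D.epsSystem k).IsInterval x.proj x ((D.epsSystem k).c x) := by
  have hE (j : ℕ) : D.endWalk k x (EpsVertex.next^[j] x) (x.dist j) =
      D.incl k x ∘ₗ D.coord k x ∘ₗ D.endWalk k x (EpsVertex.next^[j] x) (x.dist j) := by
    rw [coord_comp_endWalk]
    rfl
  refine ⟨toH (D.coord k x), ⟨?_, fun j => ?_⟩, span_toH_eq_top _ fun f => ?_⟩
  · rw [w_smul_toH]
    congr 1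
    change D.coord k x ∘ₗ D.endWalk k x x 0 = D.coord k x
    rw [endWalk_zero, ← LinearMap.comp_assoc, coord_comp_incl, LinearMap.id_comp]
  · rw [w_smul_toH, ← SerialSystem.w_eq_zero_iff, toH_eq_zero_iff]
    refine Iff.trans ?_ (MulOpposite.op_eq_zero_iff _).symm
    constructor
    · intro h
      rw [hE, h, LinearMap.comp_zero]
    · intro h
      rw [h, LinearMap.comp_zero]
  · refine ⟨D.incl k x ∘ₗ f, ?_⟩
    rw [← LinearMap.comp_assoc, coord_comp_incl, LinearMap.id_comp]

/-- The generator is the projection to `P_x` followed by `P_x → Δ_x`. It generates because maps from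
the projective module `⊕ P_i` to `Δ_x` lift to `P_x`; one jump or more lands in the submodule
factored out. -/
theorem isInterval_simple (x : D.EpsVertex k) : (D.epsSystem k).IsInterval x.simple x 1 := by
  let X := (Submodule.span (D.Alg k)ᵐᵒᵖ {D.walk k x.val (D.gap x.val)}).submoduleOf
    (D.Proj k x.val)
  have hgap := (D.gap_mem x.val).1
  have hu : X.mkQ ∘ₗ D.coord k x ≠ 0 := by
    intro h
    have h1 := LinearMap.congr_fun h (D.incl k x (D.top k x.val))
    have h2 : D.coord k x (D.incl k x (D.top k x.val)) = D.top k x.val :=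
      LinearMap.congr_fun (D.coord_comp_incl k x) _
    rw [LinearMap.comp_apply, h2, LinearMap.zero_apply, Submodule.mkQ_apply,
      Submodule.Quotient.mk_eq_zero] at h1
    have h3 : D.walk k x.val 0 ∈
        Submodule.span (D.Alg k)ᵐᵒᵖ {D.walk k x.val (D.gap x.val)} := h1
    refine (D.isAt_walk_zero k x.val).w_smul_notMem ((D.system k).c_pos x.val)
      (show 0 < D.gap x.val by omega) ?_
    have h4 (d : ℕ) : (D.system k).w x.val d • D.walk k x.val 0 = D.walk k x.val d :=
      D.walk_zero_mul_walk k x.val d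
    rwa [h4, h4]
  have h0 : (X.mkQ ∘ₗ D.coord k x) ∘ₗ D.endWalk k x x 0 = X.mkQ ∘ₗ D.coord k x := by
    rw [endWalk_zero, LinearMap.comp_assoc, ← LinearMap.comp_assoc _ _ (D.coord k x),
      coord_comp_incl, LinearMap.id_comp]
  refine ⟨toH (X.mkQ ∘ₗ D.coord k x), ⟨congrArg toH h0, fun j => ?_⟩,
    span_toH_eq_top _ fun f => ?_⟩
  · rw [w_smul_toH, toH_eq_zero_iff]
    constructor
    · intro h
      by_contra hj
      obtain rfl : j = 0 := by omega
      exact hu (h0.symm.trans h)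
    · intro hj
      have hle : D.gap x.val ≤ x.dist j := by
        have := x.dist_strictMono.monotone hj
        simpa [EpsVertex.dist] using this
      obtain ⟨t, ht⟩ := Nat.exists_eq_add_of_le hle
      refine LinearMap.ext fun m => ?_
      rw [LinearMap.comp_assoc, coord_comp_endWalk, LinearMap.comp_apply, LinearMap.comp_apply,
        Submodule.mkQ_apply]
      refine (Submodule.Quotient.mk_eq_zero X).2 ?_
      change D.walk k x.val (x.dist j) * (D.coord k (EpsVertex.next^[j] x) m : D.Alg k) ∈
        Submodule.span (D.Alg k)ᵐᵒᵖ {D.walk k x.val (D.gap x.val)}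
      rw [ht, ← walk_mul_walk, mul_assoc]
      exact Submodule.smul_mem _ (MulOpposite.op _) (Submodule.mem_span_singleton_self _)
  · have := D.projective_syzProj k
    obtain ⟨g, hg⟩ := Module.projective_lifting_property X.mkQ f (Submodule.mkQ_surjective X)
    refine ⟨D.incl k x ∘ₗ g, ?_⟩
    rw [LinearMap.comp_assoc, ← LinearMap.comp_assoc _ _ (D.coord k x), coord_comp_incl,
      LinearMap.id_comp, hg]

theorem isTopIndex_iff (x : D.EpsVertex k) (j : ℕ) (y : D.EpsVertex k) :
    x.IsTopIndex j y ↔ j < (D.epsSystem k).c x ∧ y = EpsVertex.next^[j] x := by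
  have hrad := (isInterval_proj x).radPow j
  have hy := isInterval_simple y
  constructor
  · rintro ⟨e⟩
    have hj : j < (D.epsSystem k).c x := by
      by_contra hj
      have := hrad.subsingleton_iff.2 (by omega)
      have : Subsingleton y.simple := e.symm.toEquiv.subsingleton
      exact one_ne_zero (hy.subsingleton_iff.1 this)
    exact ⟨hj, (((hrad.moduleTop (by omega)).of_equiv e).vertex_eq hy one_ne_zero).symm⟩
  · rintro ⟨hj, rfl⟩
    exact (hrad.moduleTop (by omega)).nonempty_equiv hy

theorem nonempty_hom_iff (x y : D.EpsVertex k) :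
    Nonempty (x ⟶ y) ↔ 2 ≤ (D.epsSystem k).c x ∧ y = x.next := by
  rw [← Function.iterate_one (EpsVertex.next (D := D) (k := k)),
    ← Nat.succ_le_iff.symm.trans Iff.rfl,
    ← isTopIndex_iff]
  exact ⟨fun ⟨(e : PLift _)⟩ => e.down, fun h => ⟨(⟨h⟩ : PLift _)⟩⟩

theorem subsingleton_hom (x y : D.EpsVertex k) : Subsingleton (x ⟶ y) :=
  inferInstanceAs (Subsingleton (PLift (x.IsTopIndex 1 y)))

/-- The radical has top `next x` and length `c x - 1`, so it is projective iff this length is `0` or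
`c (next x)`. As `c x ≤ c (next x) + 1`, the remaining cases are those on the right. -/
theorem projective_radPow_one_iff (x : D.EpsVertex k) :
    ¬ Module.Projective (D.Eps k)ᵐᵒᵖ (radPow (D.Eps k)ᵐᵒᵖ x.proj 1) ↔
      2 ≤ (D.epsSystem k).c x ∧ (D.epsSystem k).c x ≤ (D.epsSystem k).c x.next := by
  have hrad := (isInterval_proj x).radPow 1
  have hpos := (D.epsSystem k).c_pos x
  have hle : (D.epsSystem k).c x ≤ (D.epsSystem k).c x.next + 1 := (D.epsSystem k).c_le x
  by_cases h1 : (D.epsSystem k).c x - 1 = 0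
  · have := hrad.subsingleton_iff.2 h1
    have : Module.Projective (D.Eps k)ᵐᵒᵖ (radPow (D.Eps k)ᵐᵒᵖ x.proj 1) := inferInstance
    simp only [this, not_true_eq_false, false_iff]
    omega
  · rw [hrad.projective_iff h1]
    change ¬ _ = (D.epsSystem k).c x.next ↔ _
    omega

theorem mem_epsRelations_iff (p : AllPaths (D.EpsVertex k)) :
    p ∈ D.epsRelations k ↔ p.2.2.length = (D.epsSystem k).c p.1 ∧ 2 ≤ (D.epsSystem k).c p.1 ∧
      (D.epsSystem k).c p.1 ≤ (D.epsSystem k).c ((D.epsSystem k).next p.1) := by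
  have hlen : (p.2.2.length : ℕ∞) = Module.length (D.Eps k)ᵐᵒᵖ p.1.proj ↔
      p.2.2.length = (D.epsSystem k).c p.1 := by
    rw [(isInterval_proj p.1).length_eq]
    exact Nat.cast_inj
  change _ ∧ _ ∧ _ ↔ _
  rw [projective_radPow_one_iff, hlen]
  refine ⟨fun h => ⟨h.2.1, h.1⟩, fun h => ⟨h.2, h.1, fun j hj => ?_⟩⟩
  rw [isTopIndex_iff]
  refine ⟨by omega, ?_⟩
  -- The condition on the vertices is automatic, since every arrow goes to the successor.
  obtain ⟨v, p₁, p₂, -, rfl, hv⟩ := p.2.2.exists_eq_comp_and_length_eq_of_lt_length j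
    (by rw [Quiver.Path.vertices_length]; omega)
  rw [← hv]
  exact SerialSystem.target_eq (S := D.epsSystem k)
    (fun x y h => ((nonempty_hom_iff x y).1 h).2) p₁

end CyclicRelations

namespace CyclicRelations

variable {N : ℕ} [NeZero N] {D : CyclicRelations N} {k : Type u} [Field k]

/-! ### The relations of the syzygy filtered algebra -/

theorem existsUnique_mem_epsRelations (x : D.EpsVertex k)
    (hx : ¬ Module.Projective (D.Eps k)ᵐᵒᵖ (radPow (D.Eps k)ᵐᵒᵖ x.proj 1)) :
    ∃! p : AllPaths (D.EpsVertex k), p ∈ D.epsRelations k ∧ p.1 = x := by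
  obtain ⟨h2, hle⟩ := (projective_radPow_one_iff x).1 hx
  have harr (x y : D.EpsVertex k) := nonempty_hom_iff x y
  obtain ⟨y, p, hp, rfl⟩ := SerialSystem.exists_path (S := D.epsSystem k)
    (fun x h => (harr x _).2 ⟨h, rfl⟩) x ((D.epsSystem k).c x - 1) (by omega)
  -- The last arrow exists because `c x ≤ c (next x) ≤ (c x - 2) + c`, with the last `c` taken at
  -- the end of the path `p`, so this value is at least `2`.
  have hc := (D.epsSystem k).c_le_add x.next ((D.epsSystem k).c x - 2)
  have hit : (D.epsSystem k).next^[(D.epsSystem k).c x - 2] x.next =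
      (D.epsSystem k).next^[(D.epsSystem k).c x - 1] x := by
    change (D.epsSystem k).next^[(D.epsSystem k).c x - 2] ((D.epsSystem k).next x) = _
    rw [← Function.iterate_succ_apply]
    congr 2
    omega
  rw [hit] at hc
  obtain ⟨e⟩ := (harr ((D.epsSystem k).next^[(D.epsSystem k).c x - 1] x) _).2 ⟨by omega, rfl⟩
  refine ⟨⟨x, _, p.cons e⟩, ⟨(mem_epsRelations_iff _).2 ⟨?_, h2, hle⟩, rfl⟩, ?_⟩
  · change p.length + 1 = (D.epsSystem k).c x
    omega
  · rintro ⟨x', z, q⟩ ⟨hq, hx'⟩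
    obtain rfl : x' = x := hx'
    refine path_eq_of_length_eq subsingleton_hom
      (fun x y z e e' => ((harr x y).1 ⟨e⟩).2.trans ((harr x z).1 ⟨e'⟩).2.symm) _ _ ?_
    have hq' : q.length = (D.epsSystem k).c x' := ((mem_epsRelations_iff _).1 hq).1
    rw [Quiver.Path.length_cons]
    omega

/-! ### Syzygies over the two algebras -/

/-- The shortest vanishing path of `Λ` from `x` ends in `𝒮'(Λ)`, so it consists of whole jumps and
no rounding occurs. -/
theorem dist_c (x : D.EpsVertex k) : x.dist ((D.epsSystem k).c x) = (D.system k).c x.val := by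
  obtain ⟨j, hj⟩ := x.exists_dist_eq _ (D.add_c_mem_syzVertices k x.val)
  have h (i : ℕ) : (D.epsSystem k).c x ≤ i ↔ j ≤ i := by
    rw [epsSystem_c_le_iff, hj, x.dist_strictMono.le_iff_le]
  rw [le_antisymm ((h j).2 le_rfl) ((h _).1 le_rfl), hj]

/-- An interval module over `Λ` and one over `ε(Λ)` correspond to each other. -/
def Corresponds (p : CyclicVertex N × ℕ) (q : D.EpsVertex k × ℕ) : Prop :=
  q.1.val = p.1 ∧ q.1.dist q.2 = p.2

/-- By `dist_c` and additivity of `dist`, `c x - n` steps over `Λ` are the remaining jumps over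
`ε(Λ)`. Nonvanishing of the syzygy keeps the subtractions from truncating. -/
theorem Corresponds.syz {p : CyclicVertex N × ℕ} {q : D.EpsVertex k × ℕ} (h : Corresponds p q)
    (hp : ((D.system k).syz p).2 ≠ 0) :
    Corresponds ((D.system k).syz p) ((D.epsSystem k).syz q) := by
  obtain ⟨x, n⟩ := p
  obtain ⟨y, m⟩ := q
  obtain ⟨rfl, rfl⟩ : y.val = x ∧ y.dist m = n := h
  change (D.system k).c y.val - y.dist m ≠ 0 at hp
  have hlt : y.dist m < y.dist ((D.epsSystem k).c y) := by
    rw [dist_c]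
    omega
  rw [y.dist_strictMono.lt_iff_lt] at hlt
  have hadd := y.dist_add m ((D.epsSystem k).c y - m)
  rw [Nat.add_sub_cancel' hlt.le, dist_c] at hadd
  refine ⟨?_, ?_⟩
  · change (EpsVertex.next^[m] y).val = (D.system k).next^[y.dist m] y.val
    rw [y.val_iterate, iterate_system_next]
  · change (EpsVertex.next^[m] y).dist ((D.epsSystem k).c y - m) = (D.system k).c y.val - y.dist m
    omega

/-- If `Λ` has infinite global dimension, then some module over `ε(Λ)` has infinitely many nonzero
syzygies. -/
theorem exists_epsSystem_syz_ne_zero (h : rightGlobalDimension (D.Alg k) = ⊤) :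
    ∃ (y : D.EpsVertex k) (m : ℕ), m ≤ (D.epsSystem k).c y ∧
      ∀ K, ((D.epsSystem k).syz^[K] (y, m)).2 ≠ 0 := by
  obtain ⟨x, hx⟩ := (D.system k).exists_syz_ne_zero_of_rightGlobalDimension_eq_top h
  set p : ℕ → CyclicVertex N × ℕ := fun K => (D.system k).syz^[K] (x, 1)
  have hp (K : ℕ) : p (K + 1) = (D.system k).syz (p K) := Function.iterate_succ_apply' _ _ _
  have hne (K : ℕ) : (p K).2 ≠ 0 := hx K
  have hfst (K : ℕ) : (p (K + 1)).1 = (p K).1 + ((p K).2 : CyclicVertex N) := by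
    rw [hp]
    exact D.iterate_system_next k _ _
  have hsnd (K : ℕ) : (p (K + 1)).2 = (D.system k).c (p K).1 - (p K).2 := by
    rw [hp]
    rfl
  -- The tops two syzygies apart differ by the length of a projective, so the later one is the
  -- target of a shortest vanishing path.
  have hmem (K : ℕ) : (p (K + 2)).1 ∈ D.syzVertices := by
    have h1 := D.add_c_mem_syzVertices k (p K).1
    have h2 := hsnd K
    have h3 := hne (K + 1)
    have h4 : (D.system k).c (p K).1 = (p K).2 + (p (K + 1)).2 := by omega
    rw [h4, Nat.cast_add, ← add_assoc, ← hfst, ← hfst] at h1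
    exact h1
  -- From the second syzygy on the top lies in `𝒮'(Λ)`; the end also does, being the top of the next
  -- syzygy. So the comparison starts here.
  let y : D.EpsVertex k := ⟨(p 2).1, hmem 0⟩
  obtain ⟨m, hm⟩ := y.exists_dist_eq (p 2).2 (by
    have := hmem 1
    rw [hfst 2] at this
    exact this)
  have hcorr (K : ℕ) : Corresponds (p (K + 2)) ((D.epsSystem k).syz^[K] (y, m)) := by
    induction K with
    | zero => exact ⟨rfl, hm.symm⟩
    | succ K ih =>
      rw [Function.iterate_succ_apply', show K + 1 + 2 = (K + 2) + 1 by omega, hp]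
      refine ih.syz ?_
      rw [← hp]
      exact hne _
  refine ⟨y, m, ?_, fun K h0 => hne (K + 2) ?_⟩
  · rw [← y.dist_strictMono.le_iff_le, ← hm, dist_c]
    have h1 := hsnd 2
    have h2 := hne (2 + 1)
    have h3 : (D.system k).c y.val = (D.system k).c (p 2).1 := rfl
    rw [h3]
    omega
  · rw [← (hcorr K).2, h0]
    rfl

end CyclicRelations

/-! ### The main theorem -/

open CyclicRelations in
theorem mainTheorem4 {k : Type u} [Field k] {N : ℕ} [NeZero N] (hN : 2 ≤ N)
    (D : CyclicRelations N) :
    -- `ε(Λ)` is a Nakayama algebra, and its indecomposable modules are uniserial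
    IsNakayama k (D.Eps k) ∧
    (∀ (M : Type u) [AddCommGroup M] [Module (D.Eps k)ᵐᵒᵖ M], Module.Finite (D.Eps k)ᵐᵒᵖ M →
      IsIndecomposable (D.Eps k)ᵐᵒᵖ M → IsUniserial (D.Eps k)ᵐᵒᵖ M) ∧
    -- the modules `H(Δ)`, `Δ ∈ ℬ(Λ)`, are a complete set of representatives of the simple modules
    (∀ x : D.EpsVertex k, IsSimpleModule (D.Eps k)ᵐᵒᵖ x.simple) ∧
    (∀ x y : D.EpsVertex k, Nonempty (x.simple ≃ₗ[(D.Eps k)ᵐᵒᵖ] y.simple) → x = y) ∧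
    (∀ (M : Type u) [AddCommGroup M] [Module (D.Eps k)ᵐᵒᵖ M], IsSimpleModule (D.Eps k)ᵐᵒᵖ M →
      ∃ x : D.EpsVertex k, Nonempty (M ≃ₗ[(D.Eps k)ᵐᵒᵖ] x.simple)) ∧
    Fintype.card (D.EpsVertex k) = D.rel.card ∧
    -- the modules `H(P_x)` are the indecomposable projective modules
    (∀ x : D.EpsVertex k, Module.Finite (D.Eps k)ᵐᵒᵖ x.proj ∧
      Module.Projective (D.Eps k)ᵐᵒᵖ x.proj ∧ IsIndecomposable (D.Eps k)ᵐᵒᵖ x.proj) ∧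
    (∀ (M : Type u) [AddCommGroup M] [Module (D.Eps k)ᵐᵒᵖ M], Module.Finite (D.Eps k)ᵐᵒᵖ M →
      Module.Projective (D.Eps k)ᵐᵒᵖ M → IsIndecomposable (D.Eps k)ᵐᵒᵖ M →
      ∃ x : D.EpsVertex k, Nonempty (M ≃ₗ[(D.Eps k)ᵐᵒᵖ] x.proj)) ∧
    -- the quiver of `ε(Λ)`, and the tops of the radical powers of `H(P_x)`
    (∀ x y : D.EpsVertex k,
      Nonempty (x ⟶ y) ↔ radPow (D.Eps k)ᵐᵒᵖ x.proj 1 ≠ ⊥ ∧ y = x.next) ∧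
    (∀ x : D.EpsVertex k, ∃ c : ℕ, (c : ℕ∞) = Module.length (D.Eps k)ᵐᵒᵖ x.proj ∧
      radPow (D.Eps k)ᵐᵒᵖ x.proj c = ⊥ ∧
      ∀ j < c, x.IsTopIndex j (CyclicRelations.EpsVertex.next^[j] x)) ∧
    -- each minimal projective module gives exactly one relation, and these relations define `ε(Λ)`
    (∀ x : D.EpsVertex k, ¬ Module.Projective (D.Eps k)ᵐᵒᵖ (radPow (D.Eps k)ᵐᵒᵖ x.proj 1) →
      ∃! p : AllPaths (D.EpsVertex k), p ∈ D.epsRelations k ∧ p.1 = x) ∧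
    Nonempty (D.Eps k ≃ₐ[k] BoundQuiverAlgebra k (D.EpsVertex k) (D.epsRelations k)) ∧
    -- infinite global dimension
    (rightGlobalDimension (D.Alg k) = ⊤ →
      IsCyclicNakayama k (D.Eps k) D.rel.card ∧ rightGlobalDimension (D.Eps k) = ⊤) := by
  refine ⟨?_, ?_, ?_, ?_, ?_, ?_, ?_, ?_, ?_, ?_, existsUnique_mem_epsRelations, ?_, ?_⟩
  · refine ⟨?_, ?_, ?_⟩
    · exact (D.epsSystem k).unop.finite
    · intro P _ _ _ _ hP
      -- Left modules are handled by the reversed system.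
      obtain ⟨x, hx⟩ := (D.epsSystem k).unop.exists_isInterval_of_projective P hP
      exact hx.isUniserial
    · intro P _ _ _ _ hP
      obtain ⟨x, hx⟩ := (D.epsSystem k).exists_isInterval_of_projective P hP
      exact hx.isUniserial
  · intro M _ _ _ hM
    obtain ⟨x, n, hx⟩ := (D.epsSystem k).exists_isInterval_of_isIndecomposable M hM
    exact hx.isUniserial
  · exact fun x => (isInterval_simple x).isSimpleModule
  · rintro x y ⟨e⟩
    exact ((isInterval_simple x).of_equiv e).vertex_eq (isInterval_simple y) one_ne_zero
  · intro M _ _ _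
    obtain ⟨x, hx⟩ := (D.epsSystem k).exists_isInterval_of_isSimpleModule M
    exact ⟨x, hx.nonempty_equiv (isInterval_simple x)⟩
  · exact (Fintype.card_coe _).trans D.card_syzVertices
  · exact fun x => ⟨(isInterval_proj x).finite, (isInterval_proj x).projective,
      (isInterval_proj x).isIndecomposable ((D.epsSystem k).c_pos x).ne'⟩
  · intro M _ _ _ _ hM
    obtain ⟨x, hx⟩ := (D.epsSystem k).exists_isInterval_of_projective M hM
    exact ⟨x, hx.nonempty_equiv (isInterval_proj x)⟩
  · intro x y
    rw [nonempty_hom_iff, Ne, (isInterval_proj x).radPow_eq_bot_iff, not_le]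
    rfl
  · exact fun x => ⟨(D.epsSystem k).c x, (isInterval_proj x).length_eq.symm,
      ((isInterval_proj x).radPow_eq_bot_iff _).2 le_rfl,
      fun j hj => (isTopIndex_iff x j _).2 ⟨hj, rfl⟩⟩
  · exact SerialSystem.nonempty_algEquiv (S := D.epsSystem k) _ subsingleton_hom nonempty_hom_iff
      mem_epsRelations_iff
  · intro h
    obtain ⟨y, m, hm, hK⟩ := exists_epsSystem_syz_ne_zero h
    have hcard : Fintype.card (D.EpsVertex k) = D.rel.card :=
      (Fintype.card_coe _).trans D.card_syzVertices
    refine ⟨hcard ▸ (D.epsSystem k).isCyclicNakayama y.exists_iterate_eq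
      ((D.epsSystem k).two_le_c y.exists_iterate_eq hm hK), ?_⟩
    exact (D.epsSystem k).rightGlobalDimension_eq_top hm hK

end
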